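/- **Setting.** Let $D$ be a probability distribution on $\mathcal X\times\mathcal Y$ with $\mathcal Y$ finite, let $\ell(z,y)\in[0,1]$ be a (measurable) loss, $\mathcal H$ a finite nonempty class of (measurable) hypotheses on $\mathcal X$, $R(h)=\mathbb E_{(x,y)\sim D}[\ell(h(x),y)]$, $h^*\in\arg\min_{h\in\mathcal H}R(h)$, and write $\ell(z,z')=\max_{y\in\mathcal Y}|\ell(z,y)-\ell(z',y)|$ for the disagreement of two predictions. Fix $\delta>0$ and $\kappa\ge 1$. Importance-weighted active learning draws i.i.d. examples $(x_1,y_1),(x_2,y_2),\dots\sim D$ and starts with $\mathcal H_1=\mathcal H$. In round $t$ it sets $p_t=\max_{f,g\in\mathcal H_t}\ell(f(x_t),g(x_t))$ and requests the label $y_t$ (that is, $q_t=1$ rather than $q_t=0$) with probability $p_t$, independently of everything else given the past and $x_t$. With $L_t(h)=\frac1t\sum_{s\le t}\frac{q_s}{p_s}\ell(h(x_s),y_s)$ (a term with $p_s=0$ being $0$) and $\Delta_t=\sqrt{\frac2t\log\frac{2t(t+1)|\mathcal H|^2}{\delta}}$ (read as $0$ if the logarithm is negative), it then puts $\mathcal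 H_{t+1}=\{h\in\mathcal H_t: L_t(h)\le\min_{g\in\mathcal H_t}L_t(g)+\kappa\Delta_t\}$. Its output after $Q$ rounds is any $h_Q\in\arg\min_{h\in\mathcal H_Q}L_Q(h)$. **Theorem.** (1) With probability at least $1-\delta$, for all $Q\ge 2$ and every such $h_Q$, $$R(h_Q)-R(h^*)\le\frac2Q\left[\sqrt{\sum_{t=1}^Q p_t}+6\sqrt{\log\frac{2(3+Q)Q^2}{\delta}}\right]\sqrt{\log\frac{16\,Q^2|\mathcal H|^2\log Q}{\delta}}.$$ (2) With probability at least $1-2\delta$, for all $Q\ge 1$, the label complexity $N$ of $Q$ rounds satisfies $$N\le K_\ell\left\{\sum_{j=1}^{Q}\theta\,R_j^*\,Q\,p_j+\sum_{j=1}^{Q}O\!\left(\sqrt{R_j^*\,Q\,p_j\,\log\frac{Q|\mathcal H|Q}{\delta}}\right)+O\!\left(Q\log^3\frac{Q|\mathcal H|Q}{\delta}\right)\right\},$$ with universal constants in the $O$-terms, both for $N=\sum_{t\le Q}q_t$, the number of requested labels, and for $N=\sum_{t\le Q}\mathbb E[p_t\mid\mathcal F_{t-1}]$, where $\mathcal F_{t-1}$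 is the history of the first $t-1$ rounds. Here $R_j^*=\min_{h\in\mathcal H_j}R(h)$ is the best-in-class risk at round $j$; $$\theta=\sup_{r>0}\frac1r\,\mathbb E_x\Big[\sup_{h\in B(h^*,r)}\ell(h(x),h^*(x))\Big],\qquad B(h^*,r)=\{h\in\mathcal H:\mathbb E_x[\ell(h(x),h^*(x))]\le r\},$$ is the disagreement coefficient ($x$ having the marginal distribution of $D$ on $\mathcal X$); and $$K_\ell=\sup\left|\frac{\max_{y}\big(\ell(h(x),y)-\ell(h'(x'),y)\big)}{\min_{y}\big(\ell(h(x),y)-\ell(h'(x'),y)\big)}\right|\in[0,\infty],$$ the supremum being over $h,h'\in\mathcal H$, $x,x'\in\mathcal X$ (with $c/0=\infty$ for $c>0$ and $0/0=0$), is the slope asymmetry. -/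

import Mathlib

open MeasureTheory ProbabilityTheory
open scoped ENNReal

namespace IWAL

/-- The disagreement of two predictions: the largest difference of their losses over all labels. -/
noncomputable def disagreement {Z Y : Type*} (ℓ : Z → Y → ℝ) (z z' : Z) : ℝ :=
  ⨆ y : Y, |ℓ z y - ℓ z' y|

/-- The probability with which the label of `x` is requested when `V` is the current version space:
the largest disagreement at `x` of two hypotheses in `V`. -/
noncomputable def samplingProb {X Z Y : Type*} (ℓ : Z → Y → ℝ) (V : Finset (X → Z)) (x : X) : ℝ :=
  ⨆ fg : V × V, disagreement ℓ (fg.1.1 x) (fg.2.1 x)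

/-- The slack after `n` rounds, for a class of `m` hypotheses and confidence `δ`. -/
noncomputable def slack (m : ℕ) (δ : ℝ) (n : ℕ) : ℝ :=
  Real.sqrt (2 / n * Real.log (2 * n * (n + 1) * m ^ 2 / δ))

/-- The contribution of one round to the importance-weighted loss of `h`, namely
`(q / p) * ℓ (h x) y`, where `p` is the sampling probability of `x` and where the query indicator
`q` is obtained by comparing `p` with the coin `u`. -/
noncomputable def weightedLoss {X Z Y : Type*} (ℓ : Z → Y → ℝ) (V : Finset (X → Z))
    (e : (X × Y) × ℝ) (h : X → Z) : ℝ :=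
  (if e.2 < samplingProb ℓ V e.1.1 then 1 else 0) / samplingProb ℓ V e.1.1 * ℓ (h e.1.1) e.1.2

open Classical in
/-- Importance-weighted active learning on the data stream `d`. Round `n` (counted from `0`) uses
the example `(x, y) = (d n).1` and the coin `(d n).2`. The state after `n` rounds is the version
space together with the cumulative importance-weighted loss of each hypothesis. A round keeps the
hypotheses whose average importance-weighted loss exceeds the smallest one in the version space by
at most `κ` times the slack. -/
noncomputable def run {X Z Y : Type*} (ℓ : Z → Y → ℝ) (H : Finset (X → Z)) (κ δ : ℝ)
    (d : ℕ → (X × Y) × ℝ) : ℕ → Finset (X → Z) × ((X → Z) → ℝ)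
  | 0 => (H, fun _ => 0)
  | n + 1 =>
    let V := (run ℓ H κ δ d n).1
    let S : (X → Z) → ℝ := fun h => (run ℓ H κ δ d n).2 h + weightedLoss ℓ V (d n) h
    (V.filter (fun h => S h / ((n + 1 : ℕ) : ℝ) ≤
      (⨅ g : V, S g.1 / ((n + 1 : ℕ) : ℝ)) + κ * slack H.card δ (n + 1)), S)

/-- The version space after `n` rounds, which is the one in use during round `n`
(rounds are counted from `0`). -/
noncomputable def versionSpace {X Z Y : Type*} (ℓ : Z → Y → ℝ) (H : Finset (X → Z)) (κ δ : ℝ)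
    (d : ℕ → (X × Y) × ℝ) (n : ℕ) : Finset (X → Z) :=
  (run ℓ H κ δ d n).1

/-- The average importance-weighted loss of `h` over the first `n` rounds. -/
noncomputable def empLoss {X Z Y : Type*} (ℓ : Z → Y → ℝ) (H : Finset (X → Z)) (κ δ : ℝ)
    (d : ℕ → (X × Y) × ℝ) (n : ℕ) (h : X → Z) : ℝ :=
  (run ℓ H κ δ d n).2 h / n

/-- The sampling probability that the algorithm uses in round `n` (counted from `0`). -/
noncomputable def roundProb {X Z Y : Type*} (ℓ : Z → Y → ℝ) (H : Finset (X → Z)) (κ δ : ℝ)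
    (d : ℕ → (X × Y) × ℝ) (n : ℕ) : ℝ :=
  samplingProb ℓ (versionSpace ℓ H κ δ d n) (d n).1.1

/-- `h` is a possible output after `Q ≥ 1` rounds: it minimizes the importance-weighted empirical
loss of the `Q` rounds over the version space in use during the last of them. -/
def IsOutput {X Z Y : Type*} (ℓ : Z → Y → ℝ) (H : Finset (X → Z)) (κ δ : ℝ)
    (d : ℕ → (X × Y) × ℝ) (Q : ℕ) (h : X → Z) : Prop :=
  h ∈ versionSpace ℓ H κ δ d (Q - 1) ∧
    ∀ g ∈ versionSpace ℓ H κ δ d (Q - 1), empLoss ℓ H κ δ d Q h ≤ empLoss ℓ H κ δ d Q g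

open Classical in
/-- The number of labels requested in the first `Q` rounds. -/
noncomputable def labelCount {X Z Y : Type*} (ℓ : Z → Y → ℝ) (H : Finset (X → Z)) (κ δ : ℝ)
    (d : ℕ → (X × Y) × ℝ) (Q : ℕ) : ℕ :=
  ((Finset.range Q).filter (fun j => (d j).2 < roundProb ℓ H κ δ d j)).card

/-- The sum over the first `Q` rounds of the conditional probability, given the earlier rounds,
that the label is requested. -/
noncomputable def expectedLabels {X Z Y : Type*} [MeasurableSpace X] [MeasurableSpace Y]
    (D : Measure (X × Y)) (ℓ : Z → Y → ℝ) (H : Finset (X → Z)) (κ δ : ℝ)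
    (d : ℕ → (X × Y) × ℝ) (Q : ℕ) : ℝ :=
  ∑ j ∈ Finset.range Q, ∫ x, samplingProb ℓ (versionSpace ℓ H κ δ d j) x ∂D.fst

/-- The expected loss. -/
noncomputable def risk {X Z Y : Type*} [MeasurableSpace X] [MeasurableSpace Y]
    (D : Measure (X × Y)) (ℓ : Z → Y → ℝ) (h : X → Z) : ℝ :=
  ∫ e, ℓ (h e.1) e.2 ∂D

/-- The best risk in the version space in use during round `n` (counted from `0`). -/
noncomputable def bestRisk {X Z Y : Type*} [MeasurableSpace X] [MeasurableSpace Y]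
    (D : Measure (X × Y)) (ℓ : Z → Y → ℝ) (H : Finset (X → Z)) (κ δ : ℝ)
    (d : ℕ → (X × Y) × ℝ) (n : ℕ) : ℝ :=
  ⨅ h : versionSpace ℓ H κ δ d n, risk D ℓ h.1

/-- The expected disagreement of two hypotheses. -/
noncomputable def dist {X Z Y : Type*} [MeasurableSpace X] [MeasurableSpace Y]
    (D : Measure (X × Y)) (ℓ : Z → Y → ℝ) (f g : X → Z) : ℝ :=
  ∫ x, disagreement ℓ (f x) (g x) ∂D.fst

/-- The disagreement coefficient: the supremum over `r > 0` of
`E_x sup { disagreement of h and hstar at x : h in the r-ball around hstar } / r`. -/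
noncomputable def disagreementCoeff {X Z Y : Type*} [MeasurableSpace X] [MeasurableSpace Y]
    (D : Measure (X × Y)) (ℓ : Z → Y → ℝ) (H : Finset (X → Z)) (hstar : X → Z) : ℝ≥0∞ :=
  ⨆ (r : ℝ) (_ : 0 < r),
    (∫⁻ x, ⨆ h ∈ {h | h ∈ H ∧ dist D ℓ h hstar ≤ r},
      ENNReal.ofReal (disagreement ℓ (h x) (hstar x)) ∂D.fst) / ENNReal.ofReal r

/-- The slope asymmetry of the loss, over all pairs of predictions that the class makes.
In `ℝ≥0∞` a positive number divided by `0` is `∞`, and identical loss profiles (`0 / 0`) do not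
contribute to the supremum. -/
noncomputable def slopeAsymmetry {X Z Y : Type*} (ℓ : Z → Y → ℝ) (H : Finset (X → Z)) : ℝ≥0∞ :=
  ⨆ (h ∈ H) (h' ∈ H) (x : X) (x' : X),
    ENNReal.ofReal |⨆ y : Y, (ℓ (h x) y - ℓ (h' x') y)| /
      ENNReal.ofReal |⨅ y : Y, (ℓ (h x) y - ℓ (h' x') y)|

/-- The bound on the excess risk after `Q` rounds. -/
noncomputable def riskBound {X Z Y : Type*} (ℓ : Z → Y → ℝ) (H : Finset (X → Z)) (κ δ : ℝ)
    (d : ℕ → (X × Y) × ℝ) (Q : ℕ) : ℝ :=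
  2 / (Q : ℝ) * (Real.sqrt (∑ t ∈ Finset.range Q, roundProb ℓ H κ δ d t) +
      6 * Real.sqrt (Real.log (2 * (3 + (Q : ℝ)) * (Q : ℝ) ^ 2 / δ))) *
    Real.sqrt (Real.log (16 * (Q : ℝ) ^ 2 * (H.card : ℝ) ^ 2 * Real.log (Q : ℝ) / δ))

/-- The bound on the label complexity of `Q` rounds, where `C` is the constant hidden in the
`O`-terms. -/
noncomputable def labelBound {X Z Y : Type*} [MeasurableSpace X] [MeasurableSpace Y] (C : ℝ)
    (D : Measure (X × Y)) (ℓ : Z → Y → ℝ) (H : Finset (X → Z)) (hstar : X → Z) (κ δ : ℝ)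
    (d : ℕ → (X × Y) × ℝ) (Q : ℕ) : ℝ≥0∞ :=
  slopeAsymmetry ℓ H *
    ((∑ j ∈ Finset.range Q, disagreementCoeff D ℓ H hstar *
        ENNReal.ofReal (bestRisk D ℓ H κ δ d j * Q * roundProb ℓ H κ δ d j)) +
      (∑ j ∈ Finset.range Q, ENNReal.ofReal (C *
        Real.sqrt (bestRisk D ℓ H κ δ d j * Q * roundProb ℓ H κ δ d j *
          Real.log ((Q : ℝ) * H.card * Q / δ)))) +
      ENNReal.ofReal (C * (Q * Real.log ((Q : ℝ) * H.card * Q / δ) ^ 3)))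

end IWAL

/-! Part (1). The version space of a round is determined by the past, and the new example and coin
are independent of the past. So if E exp(ξ_v) ≤ 1 for every possible version space v, the product of
the factors exp(ξ_{V_i}(ζ_i)) has mean at most 1, and Markov's inequality bounds the tail of the sum
of the exponents (`measure_sum_ge_le`).

Four families ξ are used. For two surviving hypotheses the weighted loss difference has mean equal
to the risk difference and is at most the query indicator in absolute value. Hoeffding's lemma then
keeps every deviation below the slack, so that `hstar` is never eliminated, and a Bernstein bound at
each dyadic scale 2^(-k) controls the deviation by the conditional query probabilities. The other
two families compare the sum of these probabilities, and the number of queries, with the observed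
sum of the p_t. All failure probabilities together are dominated by a telescoping series of sum δ
(`measure_exists_fails_le`). Outside the failures the output does not lose to `hstar` empirically,
so Q times its excess risk is at most `excess`; `deviation_le` picks the right scale and gives the
stated constants.

Part (2). Neither label count exceeds Q, and for δ < 1/2 the term 4 Q log³ alone is at least Q, so
the other two terms can be dropped. What remains is that the prefactor K_ℓ is at least 1
(`one_le_slopeAsymmetry_of_ne`). This can fail only if all hypotheses have the same losses at every
point; then every p_t is 0 and almost surely no label is requested. -/

namespace IWAL

/-! ### Exponential tail bounds for adaptively chosen sums -/

section Adaptive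

variable {Ω E 𝒱 : Type*} [MeasurableSpace E]

/-- The σ-algebra generated by the first `n` observations. -/
abbrev past (ζ : ℕ → Ω → E) (n : ℕ) : MeasurableSpace Ω :=
  ⨆ i ∈ {i | i < n}, MeasurableSpace.comap (ζ i) inferInstance

lemma past_mono (ζ : ℕ → Ω → E) {m n : ℕ} (h : m ≤ n) : past ζ m ≤ past ζ n :=
  biSup_mono fun _ hi => lt_of_lt_of_le hi h

lemma measurable_past_succ (ζ : ℕ → Ω → E) (n : ℕ) : Measurable[past ζ (n + 1)] (ζ n) := by
  rw [measurable_iff_comap_le]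
  exact le_iSup₂_of_le (f := fun i (_ : i ∈ {i | i < n + 1}) => MeasurableSpace.comap (ζ i) _)
    n (Nat.lt_succ_self n) le_rfl

/-- Evaluating a family of measurable functions at a parameter that takes finitely many values. -/
lemma measurable_eval_of_finite {β : Type*} [MeasurableSpace β] {m : MeasurableSpace Ω}
    {s : Finset 𝒱} {V : Ω → 𝒱} (hVs : ∀ ω, V ω ∈ s)
    (hV : ∀ v, MeasurableSet[m] {ω | V ω = v}) {f : 𝒱 → Ω → β}
    (hf : ∀ v ∈ s, Measurable[m] (f v)) : Measurable[m] fun ω => f (V ω) ω := by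
  intro t ht
  have : (fun ω => f (V ω) ω) ⁻¹' t = ⋃ v ∈ s, {ω | V ω = v} ∩ f v ⁻¹' t := by
    ext ω
    simp only [Set.mem_preimage, Set.mem_iUnion, Set.mem_inter_iff, Set.mem_ofPred_eq]
    constructor
    · intro h
      exact ⟨V ω, hVs ω, rfl, h⟩
    · rintro ⟨v, _, rfl, h⟩
      exact h
  rw [this]
  exact Finset.measurableSet_biUnion s fun v hv => (hV v).inter (hf v hv ht)

variable {ζ : ℕ → Ω → E} {s : Finset 𝒱} {V : ℕ → Ω → 𝒱}

lemma measurable_prod_past (hVs : ∀ n ω, V n ω ∈ s)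
    (hV : ∀ n v, MeasurableSet[past ζ n] {ω | V n ω = v}) {g : 𝒱 → E → ℝ≥0∞}
    (hg : ∀ v ∈ s, Measurable (g v)) (n : ℕ) :
    Measurable[past ζ n] fun ω => ∏ i ∈ Finset.range n, g (V i ω) (ζ i ω) := by
  refine Finset.measurable_fun_prod _ fun i hi => ?_
  have hi' : i + 1 ≤ n := by simpa using hi
  refine measurable_eval_of_finite (f := fun v ω => g v (ζ i ω)) (hVs i)
    (fun v => past_mono ζ (by omega) _ (hV i v)) fun v hv => ?_
  exact (hg v hv).comp ((measurable_past_succ ζ i).mono (past_mono ζ hi') le_rfl)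

variable [MeasurableSpace Ω]

lemma past_le (hζ : ∀ t, Measurable (ζ t)) (n : ℕ) :
    past ζ n ≤ ‹MeasurableSpace Ω› :=
  iSup₂_le fun i _ => (hζ i).comap_le

lemma indep_past {μ : Measure Ω} (hζ : ∀ t, Measurable (ζ t))
    (hind : iIndepFun ζ μ) (n : ℕ) :
    Indep (past ζ n) (MeasurableSpace.comap (ζ n) inferInstance) μ := by
  have h := indep_iSup_of_disjoint (fun i => (hζ i).comap_le) hind
    (S := {i | i < n}) (T := {n}) (by simp)
  simpa [past] using h

variable {μ : Measure Ω} [IsProbabilityMeasure μ] {P : Measure E}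

/-- A product of nonnegative factors with mean at most one, each chosen on the basis of the past,
has mean at most one. -/
lemma lintegral_prod_le_one (hζ : ∀ t, Measurable (ζ t)) (hind : iIndepFun ζ μ)
    (hlaw : ∀ t, μ.map (ζ t) = P) (hVs : ∀ n ω, V n ω ∈ s)
    (hV : ∀ n v, MeasurableSet[past ζ n] {ω | V n ω = v}) {g : 𝒱 → E → ℝ≥0∞}
    (hg : ∀ v ∈ s, Measurable (g v)) (hg1 : ∀ v ∈ s, ∫⁻ e, g v e ∂P ≤ 1) (n : ℕ) :
    ∫⁻ ω, ∏ i ∈ Finset.range n, g (V i ω) (ζ i ω) ∂μ ≤ 1 := by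
  classical
  induction n with
  | zero => simp
  | succ n ih =>
    set M : Ω → ℝ≥0∞ := fun ω => ∏ i ∈ Finset.range n, g (V i ω) (ζ i ω) with hM
    have hMm : Measurable[past ζ n] M := measurable_prod_past hVs hV hg n
    -- Splitting by the finitely many values of `V n` freezes the parameter of the last factor. Each
    -- summand is then a function of the past times a function of `ζ n`, and independence applies
    -- without conditional expectations.
    have hsplit : ∀ ω, ∏ i ∈ Finset.range (n + 1), g (V i ω) (ζ i ω)
        = ∑ v ∈ s, {ω | V n ω = v}.indicator M ω * g v (ζ n ω) := by
      intro ω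
      rw [Finset.prod_range_succ, Finset.sum_eq_single_of_mem (V n ω) (hVs n ω)]
      · simp [hM]
      · intro v _ hne
        rw [Set.indicator_of_notMem (by simpa using hne.symm), zero_mul]
    have hsplit' : ∀ ω, M ω = ∑ v ∈ s, {ω | V n ω = v}.indicator M ω := by
      intro ω
      rw [Finset.sum_eq_single_of_mem (V n ω) (hVs n ω)]
      · simp
      · intro v _ hne
        rw [Set.indicator_of_notMem (by simpa using hne.symm)]
    have hIm : ∀ v, Measurable[past ζ n] ({ω | V n ω = v}.indicator M) := fun v =>
      Measurable.indicator hMm (hV n v)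
    simp_rw [hsplit]
    rw [lintegral_finsetSum]
    · calc ∑ v ∈ s, ∫⁻ ω, {ω | V n ω = v}.indicator M ω * g v (ζ n ω) ∂μ
          ≤ ∑ v ∈ s, ∫⁻ ω, {ω | V n ω = v}.indicator M ω ∂μ := by
            refine Finset.sum_le_sum fun v hv => ?_
            rw [lintegral_mul_eq_lintegral_mul_lintegral_of_independent_measurableSpace
              (g := fun ω => g v (ζ n ω)) (past_le hζ n) (hζ n).comap_le
              (indep_past hζ hind n) (hIm v) ((hg v hv).comp (comap_measurable (ζ n)))]
            have h1 : ∫⁻ ω, g v (ζ n ω) ∂μ ≤ 1 := by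
              rw [← lintegral_map (hg v hv) (hζ n), hlaw n]
              exact hg1 v hv
            exact mul_le_of_le_one_right' h1
        _ = ∫⁻ ω, M ω ∂μ := by
            rw [← lintegral_finsetSum]
            · simp_rw [← hsplit']
            · exact fun v _ => (hIm v).mono (past_le hζ n) le_rfl
        _ ≤ 1 := ih
    · exact fun v hv => ((hIm v).mono (past_le hζ n) le_rfl).mul ((hg v hv).comp (hζ n))

/-- The exponential tail bound for a sum of adaptively chosen terms. -/
lemma measure_sum_ge_le (hζ : ∀ t, Measurable (ζ t)) (hind : iIndepFun ζ μ)
    (hlaw : ∀ t, μ.map (ζ t) = P) (hVs : ∀ n ω, V n ω ∈ s)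
    (hV : ∀ n v, MeasurableSet[past ζ n] {ω | V n ω = v}) {ξ : 𝒱 → E → ℝ}
    (hξ : ∀ v ∈ s, Measurable (ξ v))
    (hξ1 : ∀ v ∈ s, ∫⁻ e, ENNReal.ofReal (Real.exp (ξ v e)) ∂P ≤ 1) (n : ℕ) (L : ℝ) :
    μ {ω | L ≤ ∑ i ∈ Finset.range n, ξ (V i ω) (ζ i ω)} ≤ ENNReal.ofReal (Real.exp (-L)) := by
  have h1 := lintegral_prod_le_one hζ hind hlaw hVs hV
    (g := fun v e => ENNReal.ofReal (Real.exp (ξ v e)))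
    (fun v hv => (Real.measurable_exp.comp (hξ v hv)).ennreal_ofReal) hξ1 n
  have hmeas : Measurable fun ω => ∏ i ∈ Finset.range n,
      ENNReal.ofReal (Real.exp (ξ (V i ω) (ζ i ω))) :=
    (measurable_prod_past hVs hV (g := fun v e => ENNReal.ofReal (Real.exp (ξ v e)))
      (fun v hv => (Real.measurable_exp.comp (hξ v hv)).ennreal_ofReal) n).mono
      (past_le hζ n) le_rfl
  have hpos : ENNReal.ofReal (Real.exp L) ≠ 0 := by
    simpa using Real.exp_pos L
  have hsub : {ω | L ≤ ∑ i ∈ Finset.range n, ξ (V i ω) (ζ i ω)} ⊆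
      {ω | ENNReal.ofReal (Real.exp L) ≤ ∏ i ∈ Finset.range n,
        ENNReal.ofReal (Real.exp (ξ (V i ω) (ζ i ω)))} := by
    intro ω hω
    simp only [Set.mem_ofPred_eq] at hω ⊢
    rw [← ENNReal.ofReal_prod_of_nonneg (fun i _ => (Real.exp_pos _).le), ← Real.exp_sum]
    exact ENNReal.ofReal_le_ofReal (Real.exp_le_exp.2 hω)
  calc _ ≤ _ := measure_mono hsub
    _ ≤ (∫⁻ ω, ∏ i ∈ Finset.range n, ENNReal.ofReal (Real.exp (ξ (V i ω) (ζ i ω))) ∂μ) /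
        ENNReal.ofReal (Real.exp L) :=
      meas_ge_le_lintegral_div hmeas.aemeasurable hpos ENNReal.ofReal_ne_top
    _ ≤ 1 / ENNReal.ofReal (Real.exp L) := ENNReal.div_le_div_right h1 _
    _ = ENNReal.ofReal (Real.exp (-L)) := by
      rw [Real.exp_neg, ENNReal.ofReal_inv_of_pos (Real.exp_pos L), one_div]

end Adaptive

/-! ### Disagreement, queries and weighted loss differences -/

section Loss

variable {X Z Y : Type*} {ℓ : Z → Y → ℝ}

lemma disagreement_nonneg (z z' : Z) : 0 ≤ disagreement ℓ z z' :=
  Real.iSup_nonneg fun _ => abs_nonneg _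

lemma disagreement_le_one (hℓ : ∀ z y, 0 ≤ ℓ z y ∧ ℓ z y ≤ 1) (z z' : Z) :
    disagreement ℓ z z' ≤ 1 :=
  Real.iSup_le (fun y => abs_le.2 ⟨by linarith [hℓ z y, hℓ z' y], by linarith [hℓ z y, hℓ z' y]⟩)
    zero_le_one

lemma abs_sub_le_disagreement [Finite Y] (z z' : Z) (y : Y) :
    |ℓ z y - ℓ z' y| ≤ disagreement ℓ z z' :=
  le_ciSup (f := fun y => |ℓ z y - ℓ z' y|) (Set.finite_range _).bddAbove y

lemma samplingProb_nonneg (V : Finset (X → Z)) (x : X) : 0 ≤ samplingProb ℓ V x :=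
  Real.iSup_nonneg fun _ => disagreement_nonneg _ _

lemma samplingProb_le_one (hℓ : ∀ z y, 0 ≤ ℓ z y ∧ ℓ z y ≤ 1) (V : Finset (X → Z)) (x : X) :
    samplingProb ℓ V x ≤ 1 :=
  Real.iSup_le (fun _ => disagreement_le_one hℓ _ _) zero_le_one

lemma disagreement_le_samplingProb {V : Finset (X → Z)} {f g : X → Z} (hf : f ∈ V) (hg : g ∈ V)
    (x : X) : disagreement ℓ (f x) (g x) ≤ samplingProb ℓ V x :=
  le_ciSup (f := fun fg : V × V => disagreement ℓ (fg.1.1 x) (fg.2.1 x))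
    (Set.finite_range _).bddAbove (⟨f, hf⟩, ⟨g, hg⟩)

/-- The query indicator of a round with version space `V`. -/
noncomputable def query (ℓ : Z → Y → ℝ) (V : Finset (X → Z)) (e : (X × Y) × ℝ) : ℝ :=
  if e.2 < samplingProb ℓ V e.1.1 then 1 else 0

lemma query_nonneg (V : Finset (X → Z)) (e : (X × Y) × ℝ) : 0 ≤ query ℓ V e := by
  unfold query; split_ifs <;> norm_num

lemma query_le_one (V : Finset (X → Z)) (e : (X × Y) × ℝ) : query ℓ V e ≤ 1 := by
  unfold query; split_ifs <;> norm_num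

/-- The importance-weighted loss of `g` in one round, minus that of `f`. -/
noncomputable def weightedDiff (ℓ : Z → Y → ℝ) (V : Finset (X → Z)) (g f : X → Z)
    (e : (X × Y) × ℝ) : ℝ :=
  weightedLoss ℓ V e g - weightedLoss ℓ V e f

lemma weightedDiff_eq (V : Finset (X → Z)) (g f : X → Z) (e : (X × Y) × ℝ) :
    weightedDiff ℓ V g f e =
      query ℓ V e / samplingProb ℓ V e.1.1 * (ℓ (g e.1.1) e.1.2 - ℓ (f e.1.1) e.1.2) := by
  unfold weightedDiff weightedLoss query; ring

/-- The sampling probability dominates the disagreement of any two survivors, which cancels the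
weight 1/p. This is why the second moment is of order p and not 1/p. -/
lemma abs_weightedDiff_le [Finite Y] {V : Finset (X → Z)} {f g : X → Z} (hf : f ∈ V) (hg : g ∈ V)
    (e : (X × Y) × ℝ) : |weightedDiff ℓ V g f e| ≤ query ℓ V e := by
  have hp := samplingProb_nonneg (ℓ := ℓ) V e.1.1
  have hq := query_nonneg (ℓ := ℓ) V e
  have hd := (abs_sub_le_disagreement (ℓ := ℓ) (g e.1.1) (f e.1.1) e.1.2).trans
    (disagreement_le_samplingProb hg hf e.1.1)
  rw [weightedDiff_eq, abs_mul, abs_of_nonneg (div_nonneg hq hp)]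
  rcases hp.eq_or_lt with h0 | h0
  · simpa [← h0] using hq
  · rw [div_mul_eq_mul_div, div_le_iff₀ h0]
    exact mul_le_mul_of_nonneg_left hd hq

end Loss

/-! ### Measurability for a fixed version space -/

section Measurability

variable {X Z Y : Type*} [MeasurableSpace X] [MeasurableSpace Z] [Finite Y]
  {ℓ : Z → Y → ℝ} {V : Finset (X → Z)}

lemma measurable_samplingProb (hℓm : ∀ y, Measurable fun z => ℓ z y)
    (hV : ∀ h ∈ V, Measurable h) : Measurable (samplingProb ℓ V) := by
  refine Measurable.iSup fun fg => Measurable.iSup fun y => ?_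
  exact (((hℓm y).comp (hV _ fg.1.2)).sub ((hℓm y).comp (hV _ fg.2.2))).abs

variable [MeasurableSpace Y]

lemma measurable_query (hℓm : ∀ y, Measurable fun z => ℓ z y)
    (hV : ∀ h ∈ V, Measurable h) : Measurable (query (Y := Y) ℓ V) :=
  Measurable.ite (measurableSet_lt measurable_snd
    ((measurable_samplingProb hℓm hV).comp measurable_fst.fst)) measurable_const measurable_const

variable [MeasurableSingletonClass Y]

lemma measurable_loss (hℓm : ∀ y, Measurable fun z => ℓ z y) {h : X → Z} (hh : Measurable h) :
    Measurable fun e : X × Y => ℓ (h e.1) e.2 :=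
  measurable_from_prod_countable_left fun y => (hℓm y).comp hh

lemma measurable_weightedLoss (hℓm : ∀ y, Measurable fun z => ℓ z y)
    (hV : ∀ h ∈ V, Measurable h) {h : X → Z} (hh : Measurable h) :
    Measurable fun e : (X × Y) × ℝ => weightedLoss ℓ V e h :=
  ((measurable_query hℓm hV).div
    ((measurable_samplingProb hℓm hV).comp measurable_fst.fst)).mul
    ((measurable_loss hℓm hh).comp measurable_fst)

lemma measurable_weightedDiff (hℓm : ∀ y, Measurable fun z => ℓ z y)
    (hV : ∀ h ∈ V, Measurable h) {g f : X → Z} (hg : Measurable g) (hf : Measurable f) :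
    Measurable (weightedDiff (Y := Y) ℓ V g f) :=
  (measurable_weightedLoss hℓm hV hg).sub (measurable_weightedLoss hℓm hV hf)

end Measurability

/-! ### The run of the algorithm and its predictability -/

section Run

variable {X Z Y : Type*} {ℓ : Z → Y → ℝ} {H : Finset (X → Z)} {κ δ : ℝ} {d : ℕ → (X × Y) × ℝ}

lemma run_succ_snd (n : ℕ) (h : X → Z) : (run ℓ H κ δ d (n + 1)).2 h =
    (run ℓ H κ δ d n).2 h + weightedLoss ℓ (versionSpace ℓ H κ δ d n) (d n) h := rfl

lemma mem_versionSpace_succ {n : ℕ} {h : X → Z} : h ∈ versionSpace ℓ H κ δ d (n + 1) ↔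
    h ∈ versionSpace ℓ H κ δ d n ∧ (run ℓ H κ δ d (n + 1)).2 h / ((n + 1 : ℕ) : ℝ) ≤
      (⨅ g : versionSpace ℓ H κ δ d n, (run ℓ H κ δ d (n + 1)).2 g.1 / ((n + 1 : ℕ) : ℝ)) +
        κ * slack H.card δ (n + 1) := by
  classical
  change h ∈ Finset.filter _ _ ↔ _
  rw [Finset.mem_filter]
  rfl

lemma run_snd (n : ℕ) (h : X → Z) : (run ℓ H κ δ d n).2 h =
    ∑ i ∈ Finset.range n, weightedLoss ℓ (versionSpace ℓ H κ δ d i) (d i) h := by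
  induction n with
  | zero => rfl
  | succ n ih => rw [run_succ_snd, ih, Finset.sum_range_succ]

lemma versionSpace_antitone : Antitone (versionSpace ℓ H κ δ d) :=
  antitone_nat_of_succ_le fun _ _ h => (mem_versionSpace_succ.1 h).1

lemma versionSpace_subset (n : ℕ) : versionSpace ℓ H κ δ d n ⊆ H :=
  versionSpace_antitone (Nat.zero_le n)

lemma sum_weightedDiff (n : ℕ) (g f : X → Z) :
    ∑ i ∈ Finset.range n, weightedDiff ℓ (versionSpace ℓ H κ δ d i) g f (d i) =
      (run ℓ H κ δ d n).2 g - (run ℓ H κ δ d n).2 f := by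
  simp only [weightedDiff, Finset.sum_sub_distrib, run_snd]

variable {Ω : Type*} [MeasurableSpace X] [MeasurableSpace Z] [Finite Y] [MeasurableSpace Y]
  [MeasurableSingletonClass Y] {ζ : ℕ → Ω → (X × Y) × ℝ}

/-- The two claims need a joint induction: new losses depend on the current version space, and the
next version space depends on the new losses. -/
lemma measurable_run (hℓm : ∀ y, Measurable fun z => ℓ z y) (hH : ∀ h ∈ H, Measurable h) (n : ℕ) :
    (∀ h ∈ H, Measurable[past ζ n] fun ω => (run ℓ H κ δ (fun t => ζ t ω) n).2 h) ∧
      ∀ v, MeasurableSet[past ζ n] {ω | versionSpace ℓ H κ δ (fun t => ζ t ω) n = v} := by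
  classical
  induction n with
  | zero =>
    refine ⟨fun h _ => measurable_const, fun v => ?_⟩
    exact MeasurableSet.const (H = v)
  | succ n ih =>
    have hV : ∀ v, MeasurableSet[past ζ (n + 1)]
        {ω | versionSpace ℓ H κ δ (fun t => ζ t ω) n = v} := fun v =>
      past_mono ζ n.le_succ _ (ih.2 v)
    have hS : ∀ h ∈ H, Measurable[past ζ (n + 1)]
        fun ω => (run ℓ H κ δ (fun t => ζ t ω) (n + 1)).2 h := by
      intro h hh
      simp only [run_succ_snd]
      refine Measurable.add ((ih.1 h hh).mono (past_mono ζ n.le_succ) le_rfl) ?_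
      refine measurable_eval_of_finite (s := H.powerset)
        (V := fun ω => versionSpace ℓ H κ δ (fun t => ζ t ω) n)
        (f := fun v ω => weightedLoss ℓ v (ζ n ω) h)
        (fun ω => Finset.mem_powerset.2 (versionSpace_subset n)) hV fun v hv => ?_
      exact (measurable_weightedLoss hℓm
        (fun h hh => hH h (Finset.mem_powerset.1 hv hh)) (hH h hh)).comp (measurable_past_succ ζ n)
    refine ⟨hS, fun v => ?_⟩
    have key : {ω | versionSpace ℓ H κ δ (fun t => ζ t ω) (n + 1) = v} =
        ⋃ w ∈ H.powerset, {ω | versionSpace ℓ H κ δ (fun t => ζ t ω) n = w} ∩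
          {ω | w.filter (fun h => (run ℓ H κ δ (fun t => ζ t ω) (n + 1)).2 h / ((n + 1 : ℕ) : ℝ) ≤
            (⨅ g : w, (run ℓ H κ δ (fun t => ζ t ω) (n + 1)).2 g.1 / ((n + 1 : ℕ) : ℝ)) +
              κ * slack H.card δ (n + 1)) = v} := by
      ext ω
      simp only [Set.mem_iUnion, Set.mem_inter_iff, Set.mem_ofPred_eq]
      constructor
      · rintro rfl
        refine ⟨_, Finset.mem_powerset.2 (versionSpace_subset n), rfl, ?_⟩
        ext h
        rw [Finset.mem_filter, mem_versionSpace_succ]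
      · rintro ⟨w, _, rfl, rfl⟩
        ext h
        rw [Finset.mem_filter, mem_versionSpace_succ]
    rw [key]
    refine Finset.measurableSet_biUnion _ fun w hw => (hV w).inter ?_
    have hwH : w ⊆ H := Finset.mem_powerset.1 hw
    have hF : ∀ h ∈ w, MeasurableSet[past ζ (n + 1)] {ω |
        (run ℓ H κ δ (fun t => ζ t ω) (n + 1)).2 h / ((n + 1 : ℕ) : ℝ) ≤
            (⨅ g : w, (run ℓ H κ δ (fun t => ζ t ω) (n + 1)).2 g.1 / ((n + 1 : ℕ) : ℝ)) +
              κ * slack H.card δ (n + 1)} := by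
      intro h hh
      refine @measurableSet_le _ _ _ _ _ (past ζ (n + 1)) _ _ _ _ _
        ((hS h (hwH hh)).div_const _) (Measurable.add_const ?_ _)
      exact Measurable.iInf fun g => (hS g.1 (hwH g.2)).div_const _
    -- For `v ⊆ w` the filter of `w` equals `v` iff finitely many comparisons have prescribed truth
    -- values; otherwise the event is empty.
    by_cases hvw : v ⊆ w
    · have : {ω | w.filter (fun h =>
          (run ℓ H κ δ (fun t => ζ t ω) (n + 1)).2 h / ((n + 1 : ℕ) : ℝ) ≤
            (⨅ g : w, (run ℓ H κ δ (fun t => ζ t ω) (n + 1)).2 g.1 / ((n + 1 : ℕ) : ℝ)) +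
              κ * slack H.card δ (n + 1)) = v} = ⋂ h ∈ w, {ω |
          ((run ℓ H κ δ (fun t => ζ t ω) (n + 1)).2 h / ((n + 1 : ℕ) : ℝ) ≤
            (⨅ g : w, (run ℓ H κ δ (fun t => ζ t ω) (n + 1)).2 g.1 / ((n + 1 : ℕ) : ℝ)) +
              κ * slack H.card δ (n + 1)) ↔ h ∈ v} := by
        ext ω
        simp only [Set.mem_iInter, Set.mem_ofPred_eq, Finset.ext_iff, Finset.mem_filter]
        constructor
        · intro h a ha
          rw [← h a]
          simp [ha]
        · intro h a
          by_cases ha : a ∈ w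
          · simp only [ha, true_and, h a ha]
          · simp only [ha, false_and, false_iff]
            exact fun h' => ha (hvw h')
      rw [this]
      refine Finset.measurableSet_biInter _ fun h hh => ?_
      by_cases hv : h ∈ v
      · simpa only [hv, iff_true] using hF h hh
      · simp only [hv, iff_false]
        exact (hF h hh).compl
    · convert MeasurableSet.empty
      ext ω
      simp only [Set.mem_ofPred_eq, Set.mem_empty_iff_false, iff_false]
      rintro rfl
      exact hvw (Finset.filter_subset _ _)

end Run

/-! ### Numerical exponential inequalities and the coin -/

/-- Here 13/18 = 1/2 + 2/9: the third-order Taylor remainder is at most 2/9 · |y|³ ≤ 2/9 · y². -/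
lemma exp_le_one_add_add_sq {y : ℝ} (hy : |y| ≤ 1) : Real.exp y ≤ 1 + y + 13 / 18 * y ^ 2 := by
  have h := (abs_le.1 (Real.exp_bound hy (n := 3) (by norm_num))).2
  simp only [Finset.sum_range_succ, Finset.sum_range_zero, Nat.factorial] at h
  have h3 : |y| ^ 3 ≤ y ^ 2 := by
    rw [pow_succ, sq_abs]
    exact mul_le_of_le_one_right (sq_nonneg y) hy
  norm_num at h
  linarith

/-- With exp(p/3) ≥ 1 + p/3 + p²/18, the product with 1 - 5p/18 exceeds 1 by at least p/18 - p²/27 -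
5p³/324, which is still 1/324 at p = 1. -/
lemma exp_neg_le_of_mem_Icc {p : ℝ} (h0 : 0 ≤ p) (h1 : p ≤ 1) :
    Real.exp (-(1 / 3 * p)) ≤ 1 - 5 / 18 * p := by
  have h := Real.quadratic_le_exp_of_nonneg (x := 1 / 3 * p) (by linarith)
  have h2 : 1 ≤ (1 - 5 / 18 * p) * Real.exp (1 / 3 * p) := by
    have h3 := mul_le_mul_of_nonneg_left h (by linarith : 0 ≤ 1 - 5 / 18 * p)
    nlinarith [mul_nonneg h0 (by linarith : 0 ≤ 1 - p), mul_nonneg h0 (by nlinarith : 0 ≤ 1 - p ^ 2)]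
  rw [Real.exp_neg, inv_le_iff_one_le_mul₀ (Real.exp_pos _)]
  exact h2

lemma exp_neg_mul_one_add_le {p : ℝ} (h0 : 0 ≤ p) :
    Real.exp (-(2 / 5 * p)) * (1 + p * (Real.exp (1 / 3) - 1)) ≤ 1 := by
  have h1 := (abs_le.1 (Real.exp_bound (x := 1 / 3) (by norm_num) (n := 3) (by norm_num))).2
  norm_num [Finset.sum_range_succ, Nat.factorial] at h1
  have h2 : 1 + p * (Real.exp (1 / 3) - 1) ≤ Real.exp (2 / 5 * p) := by
    have := Real.add_one_le_exp (2 / 5 * p)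
    have h3 : p * (Real.exp (1 / 3) - 1) ≤ p * (2 / 5) := by
      apply mul_le_mul_of_nonneg_left _ h0
      linarith
    linarith
  calc _ ≤ Real.exp (-(2 / 5 * p)) * Real.exp (2 / 5 * p) :=
        mul_le_mul_of_nonneg_left h2 (Real.exp_pos _).le
    _ = 1 := by rw [← Real.exp_add]; simp

lemma lintegral_exp_le_one {E : Type*} [MeasurableSpace E] {P : Measure E} {ξ φ : E → ℝ}
    (h : ∀ e, Real.exp (ξ e) ≤ φ e) (hφ : Integrable φ P) (hφ1 : ∫ e, φ e ∂P ≤ 1) :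
    ∫⁻ e, ENNReal.ofReal (Real.exp (ξ e)) ∂P ≤ 1 := by
  calc _ ≤ ∫⁻ e, ENNReal.ofReal (φ e) ∂P :=
        lintegral_mono fun e => ENNReal.ofReal_le_ofReal (h e)
    _ = ENNReal.ofReal (∫ e, φ e ∂P) :=
        (ofReal_integral_eq_lintegral_ofReal hφ
          (Filter.Eventually.of_forall fun e => (Real.exp_pos _).le.trans (h e))).symm
    _ ≤ 1 := by simpa using ENNReal.ofReal_le_ofReal hφ1

/-- The law of a coin. -/
noncomputable abbrev coin : Measure ℝ := volume.restrict (Set.Icc (0 : ℝ) 1)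

instance : IsProbabilityMeasure coin := ⟨by simp⟩

lemma integral_coin_lt {p : ℝ} (h0 : 0 ≤ p) (h1 : p ≤ 1) :
    ∫ u, (if u < p then 1 else 0 : ℝ) ∂coin = p := by
  have : (fun u : ℝ => (if u < p then 1 else 0 : ℝ)) = (Set.Iio p).indicator 1 := by
    ext u; simp [Set.indicator_apply]
  rw [this, integral_indicator_one measurableSet_Iio, measureReal_restrict_apply measurableSet_Iio]
  have : Set.Iio p ∩ Set.Icc (0 : ℝ) 1 = Set.Ico 0 p := by
    ext u
    simp only [Set.mem_inter_iff, Set.mem_Iio, Set.mem_Icc, Set.mem_Ico]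
    constructor
    · rintro ⟨h, h', _⟩; exact ⟨h', h⟩
    · rintro ⟨h, h'⟩; exact ⟨h', h, by linarith⟩
  rw [this, Real.volume_real_Ico_of_le h0, sub_zero]

/-! ### Exponential moments of one round -/

section Moments

variable {X Z Y : Type*} [MeasurableSpace X] [MeasurableSpace Z] [Finite Y] [MeasurableSpace Y]
  {ℓ : Z → Y → ℝ} {V : Finset (X → Z)} {D : Measure (X × Y)} [IsProbabilityMeasure D]

/-- The mean of the sampling probability. -/
noncomputable def meanProb (D : Measure (X × Y)) (ℓ : Z → Y → ℝ) (V : Finset (X → Z)) : ℝ :=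
  ∫ a, samplingProb ℓ V a.1 ∂D

lemma measurable_samplingProb_fst (hℓm : ∀ y, Measurable fun z => ℓ z y)
    (hV : ∀ h ∈ V, Measurable h) : Measurable fun a : X × Y => samplingProb ℓ V a.1 :=
  (measurable_samplingProb hℓm hV).comp measurable_fst

lemma integrable_samplingProb (hℓm : ∀ y, Measurable fun z => ℓ z y)
    (hℓ : ∀ z y, 0 ≤ ℓ z y ∧ ℓ z y ≤ 1) (hV : ∀ h ∈ V, Measurable h) :
    Integrable (fun a : X × Y => samplingProb ℓ V a.1) D :=
  Integrable.of_mem_Icc 0 1 (measurable_samplingProb_fst hℓm hV).aemeasurable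
    (Filter.Eventually.of_forall fun _ => ⟨samplingProb_nonneg _ _, samplingProb_le_one hℓ _ _⟩)

lemma integrable_query_mul (hℓm : ∀ y, Measurable fun z => ℓ z y)
    (hV : ∀ h ∈ V, Measurable h) {f : X × Y → ℝ} (hf : Measurable f) {C : ℝ}
    (hC : ∀ a, |f a| ≤ C) :
    Integrable (fun e => query ℓ V e * f e.1) (D.prod coin) := by
  refine Integrable.of_bound (C := C)
    ((measurable_query hℓm hV).mul (hf.comp measurable_fst)).aestronglyMeasurable
    (Filter.Eventually.of_forall fun e => ?_)
  rw [Real.norm_eq_abs, abs_mul, abs_of_nonneg (query_nonneg V e)]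
  exact (mul_le_of_le_one_left (abs_nonneg _) (query_le_one V e)).trans (hC e.1)

/-- Integrating out the coin replaces the query indicator by the sampling probability. -/
lemma integral_query_mul (hℓm : ∀ y, Measurable fun z => ℓ z y)
    (hℓ : ∀ z y, 0 ≤ ℓ z y ∧ ℓ z y ≤ 1)
    (hV : ∀ h ∈ V, Measurable h) {f : X × Y → ℝ} (hf : Measurable f) {C : ℝ}
    (hC : ∀ a, |f a| ≤ C) :
    ∫ e, query ℓ V e * f e.1 ∂D.prod coin = ∫ a, samplingProb ℓ V a.1 * f a ∂D := by
  rw [integral_prod _ (integrable_query_mul hℓm hV hf hC)]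
  refine integral_congr_ae (Filter.Eventually.of_forall fun a => ?_)
  simp only [query]
  rw [integral_mul_const, integral_coin_lt (samplingProb_nonneg _ _) (samplingProb_le_one hℓ _ _)]

lemma integrable_query (hℓm : ∀ y, Measurable fun z => ℓ z y)
    (hV : ∀ h ∈ V, Measurable h) : Integrable (query ℓ V) (D.prod coin) := by
  simpa using integrable_query_mul (D := D) hℓm hV (f := fun _ => 1) measurable_const
    (C := 1) (by simp)

lemma integral_query (hℓm : ∀ y, Measurable fun z => ℓ z y)
    (hℓ : ∀ z y, 0 ≤ ℓ z y ∧ ℓ z y ≤ 1) (hV : ∀ h ∈ V, Measurable h) :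
    ∫ e, query ℓ V e ∂D.prod coin = meanProb D ℓ V := by
  simpa [meanProb] using integral_query_mul (D := D) hℓm hℓ hV (f := fun _ => 1) measurable_const
    (C := 1) (by simp)

lemma lintegral_exp_meanProb_sub_le (hℓm : ∀ y, Measurable fun z => ℓ z y)
    (hℓ : ∀ z y, 0 ≤ ℓ z y ∧ ℓ z y ≤ 1) (hV : ∀ h ∈ V, Measurable h) :
    ∫⁻ e : (X × Y) × ℝ, ENNReal.ofReal
      (Real.exp (5 / 18 * meanProb D ℓ V - 1 / 3 * samplingProb ℓ V e.1.1)) ∂D.prod coin ≤ 1 := by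
  have hi : Integrable (fun e : (X × Y) × ℝ => samplingProb ℓ V e.1.1) (D.prod coin) :=
    (integrable_samplingProb hℓm hℓ hV).comp_fst coin
  refine lintegral_exp_le_one (φ := fun e => Real.exp (5 / 18 * meanProb D ℓ V) *
    (1 - 5 / 18 * samplingProb ℓ V e.1.1)) (fun e => ?_) ?_ ?_
  · rw [sub_eq_add_neg, Real.exp_add]
    exact mul_le_mul_of_nonneg_left (exp_neg_le_of_mem_Icc (samplingProb_nonneg _ _)
      (samplingProb_le_one hℓ _ _)) (Real.exp_pos _).le
  · exact ((integrable_const _).sub (hi.const_mul _)).const_mul _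
  · rw [integral_const_mul, integral_sub (integrable_const _) (hi.const_mul _), integral_const_mul,
      integral_fun_fst (μ := D) (ν := coin) (fun a : X × Y => samplingProb ℓ V a.1)]
    simp only [integral_const, probReal_univ, smul_eq_mul, mul_one, one_mul]
    change Real.exp (5 / 18 * meanProb D ℓ V) * (1 - 5 / 18 * meanProb D ℓ V) ≤ 1
    calc _ ≤ Real.exp (5 / 18 * meanProb D ℓ V) * Real.exp (-(5 / 18 * meanProb D ℓ V)) :=
          mul_le_mul_of_nonneg_left (Real.one_sub_le_exp_neg _) (Real.exp_pos _).le
      _ = 1 := by rw [← Real.exp_add]; simp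

/-- Given x, the query indicator is Bernoulli(p) with E exp(q/3) = 1 + p(exp(1/3) - 1) ≤ exp(2p/5).
The compensator is thus the observed p, not its mean. -/
lemma lintegral_exp_query_sub_le (hℓm : ∀ y, Measurable fun z => ℓ z y)
    (hℓ : ∀ z y, 0 ≤ ℓ z y ∧ ℓ z y ≤ 1) (hV : ∀ h ∈ V, Measurable h) :
    ∫⁻ e : (X × Y) × ℝ, ENNReal.ofReal
      (Real.exp (1 / 3 * query ℓ V e - 2 / 5 * samplingProb ℓ V e.1.1)) ∂D.prod coin ≤ 1 := by
  have hexp : Measurable fun a : X × Y => Real.exp (-(2 / 5 * samplingProb ℓ V a.1)) :=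
    Real.measurable_exp.comp ((measurable_samplingProb_fst hℓm hV).const_mul _).neg
  have hexp1 : ∀ a : X × Y, Real.exp (-(2 / 5 * samplingProb ℓ V a.1)) ≤ 1 := fun a =>
    Real.exp_le_one_iff.2 (by linarith [samplingProb_nonneg (ℓ := ℓ) V a.1])
  have hc : 0 ≤ Real.exp (1 / 3) - 1 := by linarith [Real.add_one_le_exp (1 / 3)]
  have hi : Integrable (fun a : X × Y => Real.exp (-(2 / 5 * samplingProb ℓ V a.1))) D :=
    Integrable.of_mem_Icc 0 1 hexp.aemeasurable
      (Filter.Eventually.of_forall fun a => ⟨(Real.exp_pos _).le, hexp1 a⟩)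
  have hfm : Measurable fun a : X × Y =>
      Real.exp (-(2 / 5 * samplingProb ℓ V a.1)) * (Real.exp (1 / 3) - 1) := hexp.mul_const _
  have hfb : ∀ a : X × Y,
      |Real.exp (-(2 / 5 * samplingProb ℓ V a.1)) * (Real.exp (1 / 3) - 1)| ≤
        Real.exp (1 / 3) - 1 := fun a => by
    rw [abs_of_nonneg (mul_nonneg (Real.exp_pos _).le hc)]
    exact mul_le_of_le_one_left hc (hexp1 a)
  have hqi := integrable_query_mul (D := D) hℓm hV hfm hfb
  refine lintegral_exp_le_one (φ := fun e => Real.exp (-(2 / 5 * samplingProb ℓ V e.1.1)) +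
    query ℓ V e * (Real.exp (-(2 / 5 * samplingProb ℓ V e.1.1)) * (Real.exp (1 / 3) - 1)))
    (fun e => ?_) ((hi.comp_fst coin).add hqi) ?_
  · rw [sub_eq_add_neg, Real.exp_add]
    unfold query
    split_ifs
    · apply le_of_eq; simp; ring
    · simp
  · rw [integral_add (hi.comp_fst coin) hqi, integral_query_mul hℓm hℓ hV hfm hfb,
      integral_fun_fst (μ := D) (ν := coin)
        (fun a : X × Y => Real.exp (-(2 / 5 * samplingProb ℓ V a.1)))]
    simp only [probReal_univ, one_smul]
    have hpi : Integrable (fun a : X × Y => samplingProb ℓ V a.1 *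
        (Real.exp (-(2 / 5 * samplingProb ℓ V a.1)) * (Real.exp (1 / 3) - 1))) D := by
      refine Integrable.of_bound (C := Real.exp (1 / 3) - 1)
        ((measurable_samplingProb_fst hℓm hV).mul hfm).aestronglyMeasurable
        (Filter.Eventually.of_forall fun a => ?_)
      rw [Real.norm_eq_abs, abs_mul, abs_of_nonneg (samplingProb_nonneg _ _)]
      exact (mul_le_of_le_one_left (abs_nonneg _) (samplingProb_le_one hℓ _ _)).trans (hfb a)
    rw [← integral_add hi hpi]
    calc _ ≤ ∫ _a : X × Y, (1 : ℝ) ∂D := by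
          refine integral_mono (hi.add hpi) (integrable_const _) fun a => ?_
          have := exp_neg_mul_one_add_le (samplingProb_nonneg (ℓ := ℓ) V a.1)
          simp only
          linarith
      _ = 1 := by simp

variable [MeasurableSingletonClass Y] {g f : X → Z}

/-- Importance weighting is unbiased: integrating out the coin turns q/p into 1. -/
lemma integral_weightedDiff (hℓm : ∀ y, Measurable fun z => ℓ z y)
    (hℓ : ∀ z y, 0 ≤ ℓ z y ∧ ℓ z y ≤ 1) (hV : ∀ h ∈ V, Measurable h) (hg : g ∈ V) (hf : f ∈ V) :
    ∫ e, weightedDiff ℓ V g f e ∂D.prod coin = risk D ℓ g - risk D ℓ f := by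
  have hgm := measurable_loss hℓm (hV g hg)
  have hfm := measurable_loss hℓm (hV f hf)
  have hd : ∀ a : X × Y, |ℓ (g a.1) a.2 - ℓ (f a.1) a.2| ≤ samplingProb ℓ V a.1 := fun a =>
    (abs_sub_le_disagreement _ _ _).trans (disagreement_le_samplingProb hg hf a.1)
  have hb : ∀ a : X × Y,
      |(ℓ (g a.1) a.2 - ℓ (f a.1) a.2) / samplingProb ℓ V a.1| ≤ 1 := fun a => by
    rw [abs_div, abs_of_nonneg (samplingProb_nonneg V a.1)]
    exact div_le_one_of_le₀ (hd a) (samplingProb_nonneg _ _)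
  have h := integral_query_mul (D := D) hℓm hℓ hV
    ((hgm.sub hfm).div (measurable_samplingProb_fst hℓm hV)) hb
  have hint : ∀ {k : X → Z}, Measurable (fun a : X × Y => ℓ (k a.1) a.2) →
      Integrable (fun a : X × Y => ℓ (k a.1) a.2) D := fun hk =>
    Integrable.of_mem_Icc 0 1 hk.aemeasurable (Filter.Eventually.of_forall fun a => hℓ _ _)
  calc _ = _ := by
        refine integral_congr_ae (Filter.Eventually.of_forall fun e => ?_)
        simp only [weightedDiff_eq, div_mul_eq_mul_div, mul_div_assoc]
        rfl
    _ = _ := h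
    _ = ∫ a, (ℓ (g a.1) a.2 - ℓ (f a.1) a.2) ∂D := by
        refine integral_congr_ae (Filter.Eventually.of_forall fun a => ?_)
        simp only [Pi.sub_apply, Pi.div_apply]
        -- Where p = 0 nothing is ever queried, but there the losses of the two survivors agree.
        refine mul_div_cancel_of_imp' fun h0 => ?_
        have := hd a
        rw [h0] at this
        exact abs_nonpos_iff.1 this
    _ = _ := integral_sub (hint hgm) (hint hfm)

lemma integrable_weightedDiff (hℓm : ∀ y, Measurable fun z => ℓ z y)
    (hV : ∀ h ∈ V, Measurable h) (hg : g ∈ V) (hf : f ∈ V) :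
    Integrable (weightedDiff ℓ V g f) (D.prod coin) :=
  Integrable.of_bound (C := 1)
    (measurable_weightedDiff hℓm hV (hV g hg) (hV f hf)).aestronglyMeasurable
    (Filter.Eventually.of_forall fun e =>
      (abs_weightedDiff_le hf hg e).trans (query_le_one V e))

/-- The Bernstein-type moment bound for one round. -/
lemma lintegral_exp_bernstein_le (hℓm : ∀ y, Measurable fun z => ℓ z y)
    (hℓ : ∀ z y, 0 ≤ ℓ z y ∧ ℓ z y ≤ 1) (hV : ∀ h ∈ V, Measurable h) (hg : g ∈ V) (hf : f ∈ V)
    {c : ℝ} (hc0 : 0 ≤ c) (hc1 : c ≤ 1) :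
    ∫⁻ e, ENNReal.ofReal (Real.exp (c * (risk D ℓ g - risk D ℓ f - weightedDiff ℓ V g f e) -
      13 / 18 * c ^ 2 * meanProb D ℓ V)) ∂D.prod coin ≤ 1 := by
  set r := risk D ℓ g - risk D ℓ f with hr
  have hi := integrable_weightedDiff (D := D) hℓm hV hg hf
  have hq := integrable_query (D := D) hℓm hV
  refine lintegral_exp_le_one (φ := fun e => Real.exp (c * r - 13 / 18 * c ^ 2 * meanProb D ℓ V) *
    (1 - c * weightedDiff ℓ V g f e + 13 / 18 * c ^ 2 * query ℓ V e)) (fun e => ?_) ?_ ?_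
  · rw [show c * (r - weightedDiff ℓ V g f e) - 13 / 18 * c ^ 2 * meanProb D ℓ V =
      (c * r - 13 / 18 * c ^ 2 * meanProb D ℓ V) + -(c * weightedDiff ℓ V g f e) by ring,
      Real.exp_add]
    refine mul_le_mul_of_nonneg_left ?_ (Real.exp_pos _).le
    have hx := abs_weightedDiff_le (ℓ := ℓ) hf hg e
    have hq0 := query_nonneg (ℓ := ℓ) V e
    have hq1 := query_le_one (ℓ := ℓ) V e
    have h1 := exp_le_one_add_add_sq (y := -(c * weightedDiff ℓ V g f e)) (by
      rw [abs_neg, abs_mul, abs_of_nonneg hc0]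
      exact mul_le_one₀ hc1 (abs_nonneg _) (hx.trans hq1))
    -- Being at most q ≤ 1 in absolute value, the difference has square at most q, so the
    -- conditional variance is bounded by the mean sampling probability.
    have h2 : weightedDiff ℓ V g f e ^ 2 ≤ query ℓ V e := by
      rw [← sq_abs]
      nlinarith [abs_nonneg (weightedDiff ℓ V g f e)]
    have h3 := mul_le_mul_of_nonneg_left h2 (sq_nonneg c)
    nlinarith
  · exact (((integrable_const _).sub (hi.const_mul _)).add (hq.const_mul _)).const_mul _
  · rw [integral_const_mul, integral_add (f := fun e => 1 - c * weightedDiff ℓ V g f e)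
      ((integrable_const _).sub (hi.const_mul _)) (hq.const_mul _), integral_sub (integrable_const _) (hi.const_mul _), integral_const_mul,
      integral_const_mul, integral_weightedDiff hℓm hℓ hV hg hf, integral_query hℓm hℓ hV, ← hr]
    simp only [integral_const, probReal_univ, smul_eq_mul, mul_one]
    calc _ ≤ Real.exp (c * r - 13 / 18 * c ^ 2 * meanProb D ℓ V) *
          Real.exp (-(c * r - 13 / 18 * c ^ 2 * meanProb D ℓ V)) := by
          refine mul_le_mul_of_nonneg_left ?_ (Real.exp_pos _).le
          linarith [Real.one_sub_le_exp_neg (c * r - 13 / 18 * c ^ 2 * meanProb D ℓ V)]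
      _ = 1 := by rw [← Real.exp_add]; simp

/-- The Hoeffding-type moment bound for one round. -/
lemma lintegral_exp_hoeffding_le (hℓm : ∀ y, Measurable fun z => ℓ z y)
    (hℓ : ∀ z y, 0 ≤ ℓ z y ∧ ℓ z y ≤ 1) (hV : ∀ h ∈ V, Measurable h) (hg : g ∈ V) (hf : f ∈ V)
    (c : ℝ) :
    ∫⁻ e, ENNReal.ofReal (Real.exp (c * (risk D ℓ g - risk D ℓ f - weightedDiff ℓ V g f e) -
      c ^ 2 / 2)) ∂D.prod coin ≤ 1 := by
  have hm := (measurable_weightedDiff hℓm hV (hV g hg) (hV f hf)).neg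
  -- Values in an interval of length 2 give variance proxy 1, whence c²/2.
  have hs := hasSubgaussianMGF_of_mem_Icc (μ := D.prod coin) (a := -1) (b := 1)
    (X := fun e => -weightedDiff ℓ V g f e) hm.aemeasurable
    (Filter.Eventually.of_forall fun e => by
      have := abs_le.1 ((abs_weightedDiff_le (ℓ := ℓ) hf hg e).trans (query_le_one V e))
      exact ⟨by linarith [this.2], by linarith [this.1]⟩)
  have hmean : ∫ e, -weightedDiff ℓ V g f e ∂D.prod coin = -(risk D ℓ g - risk D ℓ f) := by
    rw [integral_neg, integral_weightedDiff hℓm hℓ hV hg hf]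
  rw [hmean] at hs
  have hmgf := hs.mgf_le c
  have heq : ∀ e, Real.exp (c * (risk D ℓ g - risk D ℓ f - weightedDiff ℓ V g f e) - c ^ 2 / 2) =
      Real.exp (-(c ^ 2 / 2)) * Real.exp (c * (-weightedDiff ℓ V g f e -
        -(risk D ℓ g - risk D ℓ f))) := fun e => by
    rw [← Real.exp_add]; congr 1; ring
  refine lintegral_exp_le_one (fun e => (heq e).le) ((hs.integrable_exp_mul c).const_mul _) ?_
  rw [integral_const_mul]
  calc _ ≤ Real.exp (-(c ^ 2 / 2)) * Real.exp (c ^ 2 / 2) := by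
        refine mul_le_mul_of_nonneg_left (hmgf.trans (le_of_eq ?_)) (Real.exp_pos _).le
        norm_num
    _ = 1 := by rw [← Real.exp_add]; simp

end Moments

/-! ### Choice of scale and the deterministic deviation inequality -/

/-- The choice of the scale in the main regime. -/
lemma exists_two_pow_mem {u : ℝ} {Q : ℕ} (hQ : 2 ≤ Q) (hu : u ≤ 4 / 3) (hu' : 4 / 3 ≤ u * Q) :
    ∃ k ≤ Nat.log 2 Q, 3 / 4 * u ≤ (1 / 2 : ℝ) ^ k ∧ (1 / 2 : ℝ) ^ k ≤ 3 / 2 * u := by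
  have hQ0 : (0 : ℝ) < Q := by positivity
  have hu0 : 0 < u := by
    by_contra h
    nlinarith
  by_cases h1 : 1 ≤ 3 / 2 * u
  · exact ⟨0, by simp, by simp; linarith, by simpa using h1⟩
  obtain ⟨k, hk1, hk2⟩ := exists_nat_pow_near_of_lt_one (x := 3 / 2 * u) (y := (1 / 2 : ℝ))
    (by linarith) (by linarith) (by norm_num) (by norm_num)
  refine ⟨k + 1, ?_, ?_, hk1.le⟩
  -- By `hu'` the chosen power is at least 3u/4 ≥ 1/Q, so scales beyond log₂ Q never occur and the
  -- union bound over scales is short.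
  · apply Nat.le_log_of_pow_le (by norm_num)
    have h2 : (1 / 2 : ℝ) ^ (k + 1) * 2 ^ (k + 1) = 1 := by
      rw [← mul_pow]; norm_num
    have h3 : 3 / 4 * u ≤ (1 / 2 : ℝ) ^ (k + 1) := by rw [pow_succ]; linarith
    have h4 : (2 : ℝ) ^ (k + 1) ≤ Q := by
      have h5 : (1 : ℝ) ≤ (1 / 2 : ℝ) ^ (k + 1) * Q := by nlinarith
      have h6 : (0 : ℝ) < 2 ^ (k + 1) := by positivity
      nlinarith
    exact_mod_cast h4
  · rw [pow_succ]; linarith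

/-- The deterministic combination of the deviation bounds. -/
lemma deviation_le {D S V N l L : ℝ} {Q : ℕ} (hQ : 2 ≤ Q) (hS : 0 ≤ S) (hSQ : S ≤ Q)
    (hl : 0 ≤ l) (hL : 16 / 9 ≤ L) (hlL : l ≤ 3 * L) (hD : D ≤ N + V)
    (hV : 5 / 18 * V - 1 / 3 * S ≤ l) (hN : 1 / 3 * N - 2 / 5 * S ≤ l)
    (hF : ∀ k ≤ Nat.log 2 Q, (1 / 2 : ℝ) ^ k * D - 13 / 18 * ((1 / 2 : ℝ) ^ k) ^ 2 * V ≤ L) :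
    D ≤ 2 * (√S + 6 * √l) * √L := by
  have hL0 : 0 ≤ L := by linarith
  set a := √S with ha
  set b := √l with hb
  set c := √L with hc
  have ha2 : a ^ 2 = S := Real.sq_sqrt hS
  have hb2 : b ^ 2 = l := Real.sq_sqrt hl
  have hc2 : c ^ 2 = L := Real.sq_sqrt hL0
  have ha0 : 0 ≤ a := Real.sqrt_nonneg _
  have hb0 : 0 ≤ b := Real.sqrt_nonneg _
  have hc0 : 4 / 3 ≤ c := Real.le_sqrt_of_sq_le (by linarith)
  have hbc : b ≤ 9 / 5 * c := by
    apply Real.sqrt_le_iff.2 ⟨by linarith, by nlinarith⟩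
  have hbbc : b ^ 2 ≤ 9 / 5 * (b * c) := by nlinarith
  -- Always V ≤ 6/5 · a² + 18/5 · b² and N ≤ 6/5 · a² + 3b². For small a the crude bound N + V
  -- suffices: 12/5 · a² ≤ 2ac and 33/5 · b² ≤ 297/25 · bc ≤ 12bc. Otherwise the Bernstein bound is
  -- used at a scale comparable to c/a.
  rcases le_or_gt (6 / 5 * a) c with h | h
  · have h1 : a ^ 2 * (6 / 5) ≤ a * c := by nlinarith
    nlinarith [mul_nonneg hb0 (by linarith : 0 ≤ c)]
  · have ha1 : 0 < a := by linarith
    have haQ : a ^ 2 ≤ Q := by rw [ha2]; exact hSQ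
    have hQ2 : (2 : ℝ) ≤ Q := by exact_mod_cast hQ
    have haQ' : a ≤ Q := by nlinarith
    obtain ⟨k, hk, hk1, hk2⟩ := exists_two_pow_mem (u := c / a) hQ
      (by rw [div_le_iff₀ ha1]; linarith)
      (by
        rw [div_mul_eq_mul_div, le_div_iff₀ ha1]
        nlinarith)
    have hF := hF k hk
    have hx1 : (1 / 2 : ℝ) ^ k ≤ 1 := pow_le_one₀ (by norm_num) (by norm_num)
    have hx0 : 0 < (1 / 2 : ℝ) ^ k := by positivity
    set x := (1 / 2 : ℝ) ^ k with hx
    rw [← mul_div_assoc, div_le_iff₀ ha1] at hk1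
    rw [← mul_div_assoc, le_div_iff₀ ha1] at hk2
    -- This says c² ≤ 2xac - 8/9 · x²a². The negative term absorbs the variance contribution 13/18 ·
    -- 6/5 · x²a² = 13/15 · x²a².
    have h1 : (x * a - 3 / 4 * c) * (x * a - 3 / 2 * c) ≤ 0 :=
      mul_nonpos_of_nonneg_of_nonpos (by linarith) (by linarith)
    have h2 : 13 / 18 * x ^ 2 * V ≤ 13 / 18 * x ^ 2 * (6 / 5 * a ^ 2 + 18 / 5 * b ^ 2) := by
      apply mul_le_mul_of_nonneg_left _ (by positivity)
      linarith
    have h3 : x * D ≤ x * (2 * a * c + 13 / 5 * x * b ^ 2) := by nlinarith [sq_nonneg (x * a)]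
    have h4 : D ≤ 2 * a * c + 13 / 5 * x * b ^ 2 := le_of_mul_le_mul_left h3 hx0
    have h5 : x * b ^ 2 ≤ b ^ 2 := mul_le_of_le_one_left (sq_nonneg _) hx1
    nlinarith [mul_nonneg hb0 (by linarith : 0 ≤ c)]

/-! ### Estimates for the logarithmic terms -/

section Logs

lemma half_le_log {Q : ℕ} (hQ : 2 ≤ Q) : 1 / 2 ≤ Real.log (Q : ℝ) := by
  have h1 : Real.log 2 ≤ Real.log (Q : ℝ) :=
    Real.log_le_log (by norm_num) (by exact_mod_cast hQ)
  linarith [Real.log_two_gt_d9]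

/-- Bounds the number of dyadic scales; the factor log Q inside the logarithm of the risk bound pays
for it. -/
lemma natLog_add_one_le {Q : ℕ} (hQ : 2 ≤ Q) : (Nat.log 2 Q : ℝ) + 1 ≤ 3 * Real.log (Q : ℝ) := by
  have h1 : Real.log 2 ≤ Real.log (Q : ℝ) :=
    Real.log_le_log (by norm_num) (by exact_mod_cast hQ)
  have h2 : (Nat.log 2 Q : ℝ) ≤ Real.log Q / Real.log 2 := Real.natLog_le_logb Q 2
  have h0 := Real.log_two_gt_d9
  rw [le_div_iff₀ (by linarith)] at h2
  nlinarith

variable {m Q : ℕ} {δ : ℝ}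

lemma eight_mul_sq_div_le (hm : 1 ≤ m) (hQ : 2 ≤ Q) (hδ : 0 < δ) :
    8 * (Q : ℝ) ^ 2 / δ ≤ 16 * (Q : ℝ) ^ 2 * (m : ℝ) ^ 2 * Real.log Q / δ := by
  have h1 := half_le_log hQ
  have h2 : (1 : ℝ) ≤ (m : ℝ) ^ 2 := one_le_pow₀ (by exact_mod_cast hm)
  have h3 : 1 / 2 ≤ (m : ℝ) ^ 2 * Real.log Q := by nlinarith
  refine div_le_div_of_nonneg_right ?_ hδ.le
  nlinarith [mul_le_mul_of_nonneg_left h3 (by positivity : 0 ≤ 16 * (Q : ℝ) ^ 2)]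

lemma sq_le_eight_mul_sq_div (hδ : 0 < δ) (hδ1 : δ < 1) :
    8 * (Q : ℝ) ^ 2 ≤ 8 * (Q : ℝ) ^ 2 / δ :=
  le_div_self (by positivity) hδ hδ1.le

lemma le_log_pairs (hm : 1 ≤ m) (hQ : 2 ≤ Q) (hδ : 0 < δ) (hδ1 : δ < 1) :
    16 / 9 ≤ Real.log (16 * (Q : ℝ) ^ 2 * (m : ℝ) ^ 2 * Real.log Q / δ) := by
  have hQ2 : (2 : ℝ) ≤ Q := by exact_mod_cast hQ
  have h := (sq_le_eight_mul_sq_div (Q := Q) hδ hδ1).trans (eight_mul_sq_div_le hm hQ hδ)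
  have h32 : 32 ≤ 16 * (Q : ℝ) ^ 2 * (m : ℝ) ^ 2 * Real.log Q / δ := by nlinarith
  rw [Real.le_log_iff_exp_le (by linarith)]
  calc Real.exp (16 / 9) ≤ Real.exp (1 + 1) := Real.exp_le_exp.2 (by norm_num)
    _ ≤ 3 * 3 := by
      rw [Real.exp_add]
      have := Real.exp_one_lt_three
      have := Real.exp_pos 1
      nlinarith
    _ ≤ _ := by linarith

lemma log_rounds_nonneg (hQ : 2 ≤ Q) (hδ : 0 < δ) (hδ1 : δ < 1) :
    0 ≤ Real.log (2 * (3 + (Q : ℝ)) * (Q : ℝ) ^ 2 / δ) := by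
  have hQ2 : (2 : ℝ) ≤ Q := by exact_mod_cast hQ
  apply Real.log_nonneg
  rw [le_div_iff₀ hδ]
  nlinarith

/-- Allows terms linear in the round logarithm to be absorbed into the product of the two square
roots in `deviation_le`. It holds because the right-hand argument A is at least both 8Q²/δ and 3 +
Q, so A³ dominates. -/
lemma log_rounds_le (hm : 1 ≤ m) (hQ : 2 ≤ Q) (hδ : 0 < δ) (hδ1 : δ < 1) :
    Real.log (2 * (3 + (Q : ℝ)) * (Q : ℝ) ^ 2 / δ) ≤
      3 * Real.log (16 * (Q : ℝ) ^ 2 * (m : ℝ) ^ 2 * Real.log Q / δ) := by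
  have hQ2 : (2 : ℝ) ≤ Q := by exact_mod_cast hQ
  have h1 := eight_mul_sq_div_le hm hQ hδ
  have h2 := (sq_le_eight_mul_sq_div (Q := Q) hδ hδ1).trans h1
  have h0 : 0 ≤ 8 * (Q : ℝ) ^ 2 / δ := by positivity
  set A := 16 * (Q : ℝ) ^ 2 * (m : ℝ) ^ 2 * Real.log Q / δ with hA
  have h3 : 3 + (Q : ℝ) ≤ A := by nlinarith
  have h4 : 3 + (Q : ℝ) ≤ A ^ 2 := by nlinarith
  rw [show 3 * Real.log A = Real.log (A ^ 3) by rw [Real.log_pow]; norm_num]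
  apply Real.log_le_log (by positivity)
  calc 2 * (3 + (Q : ℝ)) * (Q : ℝ) ^ 2 / δ = (3 + Q) * ((8 * (Q : ℝ) ^ 2 / δ) / 4) := by ring
    _ ≤ A ^ 2 * A := by
      apply mul_le_mul h4 _ (by positivity) (by positivity)
      linarith
    _ = A ^ 3 := by ring

lemma exp_neg_log_pairs (hm : 1 ≤ m) (hQ : 2 ≤ Q) (hδ : 0 < δ) :
    Real.exp (-Real.log (16 * (Q : ℝ) ^ 2 * (m : ℝ) ^ 2 * Real.log Q / δ)) =
      δ / (16 * (Q : ℝ) ^ 2 * (m : ℝ) ^ 2 * Real.log Q) := by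
  have h := half_le_log hQ
  have h1 : 0 < Real.log Q := by linarith
  rw [Real.exp_neg, Real.exp_log (by positivity), inv_div]

lemma exp_neg_log_rounds (hQ : 2 ≤ Q) (hδ : 0 < δ) :
    Real.exp (-Real.log (2 * (3 + (Q : ℝ)) * (Q : ℝ) ^ 2 / δ)) =
      δ / (2 * (3 + (Q : ℝ)) * (Q : ℝ) ^ 2) := by
  rw [Real.exp_neg, Real.exp_log (by positivity), inv_div]

lemma one_lt_slack_arg (hm : 1 ≤ m) (hδ : 0 < δ) (hδ1 : δ < 1) (n : ℕ) :
    1 < 2 * ((n + 1 : ℕ) : ℝ) * (((n + 1 : ℕ) : ℝ) + 1) * (m : ℝ) ^ 2 / δ := by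
  have h2 : (1 : ℝ) ≤ (m : ℝ) ^ 2 := one_le_pow₀ (by exact_mod_cast hm)
  rw [lt_div_iff₀ hδ]
  push_cast
  have hn : (0 : ℝ) ≤ n := by positivity
  nlinarith [mul_nonneg hn hn]

lemma slack_pos (hm : 1 ≤ m) (hδ : 0 < δ) (hδ1 : δ < 1) (n : ℕ) : 0 < slack m δ (n + 1) := by
  have := Real.log_pos (one_lt_slack_arg hm hδ hδ1 n)
  exact Real.sqrt_pos.2 (mul_pos (by positivity) this)

lemma exp_neg_slack_sq (hm : 1 ≤ m) (hδ : 0 < δ) (hδ1 : δ < 1) (n : ℕ) :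
    Real.exp (-(((n : ℝ) + 1) * slack m δ (n + 1) ^ 2 / 2)) =
      δ / (2 * ((n : ℝ) + 1) * ((n : ℝ) + 2) * (m : ℝ) ^ 2) := by
  have h1 := one_lt_slack_arg hm hδ hδ1 n
  have hlog := Real.log_pos h1
  rw [slack, Real.sq_sqrt (by positivity)]
  have : ((n : ℝ) + 1) * (2 / ((n + 1 : ℕ) : ℝ) *
      Real.log (2 * ((n + 1 : ℕ) : ℝ) * (((n + 1 : ℕ) : ℝ) + 1) * (m : ℝ) ^ 2 / δ)) / 2 =
      Real.log (2 * ((n + 1 : ℕ) : ℝ) * (((n + 1 : ℕ) : ℝ) + 1) * (m : ℝ) ^ 2 / δ) := by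
    push_cast
    field_simp
  rw [this, Real.exp_neg, Real.exp_log (by linarith), inv_div]
  push_cast
  ring

end Logs

/-! ### Failure events and their probabilities -/

section Events

variable {X Z Y : Type*} [MeasurableSpace X] [MeasurableSpace Y]

/-- The sum over the first `n` rounds of the conditional means of the weighted loss differences of
`g` and `f`, minus the sum of these differences. -/
noncomputable def excess (D : Measure (X × Y)) (ℓ : Z → Y → ℝ) (H : Finset (X → Z)) (κ δ : ℝ)
    (d : ℕ → (X × Y) × ℝ) (g f : X → Z) (n : ℕ) : ℝ :=
  ∑ i ∈ Finset.range n,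
    (risk D ℓ g - risk D ℓ f - weightedDiff ℓ (versionSpace ℓ H κ δ d i) g f (d i))

/-- The sum over the first `n` rounds of the conditional query probabilities. -/
noncomputable def meanSum (D : Measure (X × Y)) (ℓ : Z → Y → ℝ) (H : Finset (X → Z)) (κ δ : ℝ)
    (d : ℕ → (X × Y) × ℝ) (n : ℕ) : ℝ :=
  ∑ i ∈ Finset.range n, meanProb D ℓ (versionSpace ℓ H κ δ d i)

/-- The number of queries in the first `n` rounds, as a real number. -/
noncomputable def querySum (ℓ : Z → Y → ℝ) (H : Finset (X → Z)) (κ δ : ℝ)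
    (d : ℕ → (X × Y) × ℝ) (n : ℕ) : ℝ :=
  ∑ i ∈ Finset.range n, query ℓ (versionSpace ℓ H κ δ d i) (d i)

/-- Some deviation after `n + 1` rounds reaches the slack. -/
def ReachesSlack (D : Measure (X × Y)) (ℓ : Z → Y → ℝ) (H : Finset (X → Z)) (κ δ : ℝ)
    (f : X → Z) (d : ℕ → (X × Y) × ℝ) (n : ℕ) : Prop :=
  ∃ g ∈ H, (g ∈ versionSpace ℓ H κ δ d n ∧ f ∈ versionSpace ℓ H κ δ d n) ∧
    ((n : ℝ) + 1) * slack H.card δ (n + 1) ≤ excess D ℓ H κ δ d g f (n + 1)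

/-- Some deviation after `Q` rounds is too large relative to its conditional variance. -/
def ReachesBernstein (D : Measure (X × Y)) (ℓ : Z → Y → ℝ) (H : Finset (X → Z)) (κ δ : ℝ)
    (f : X → Z) (d : ℕ → (X × Y) × ℝ) (Q : ℕ) : Prop :=
  ∃ g ∈ H, ∃ k ∈ Finset.range (Nat.log 2 Q + 1),
    (g ∈ versionSpace ℓ H κ δ d (Q - 1) ∧ f ∈ versionSpace ℓ H κ δ d (Q - 1)) ∧
      Real.log (16 * (Q : ℝ) ^ 2 * (H.card : ℝ) ^ 2 * Real.log (Q : ℝ) / δ) ≤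
        (1 / 2 : ℝ) ^ k * excess D ℓ H κ δ d g f Q -
          13 / 18 * ((1 / 2 : ℝ) ^ k) ^ 2 * meanSum D ℓ H κ δ d Q

/-- The conditional query probabilities are too large relative to the sampling probabilities. -/
def ReachesMean (D : Measure (X × Y)) (ℓ : Z → Y → ℝ) (H : Finset (X → Z)) (κ δ : ℝ)
    (d : ℕ → (X × Y) × ℝ) (Q : ℕ) : Prop :=
  Real.log (2 * (3 + (Q : ℝ)) * (Q : ℝ) ^ 2 / δ) ≤ 5 / 18 * meanSum D ℓ H κ δ d Q -
    1 / 3 * ∑ t ∈ Finset.range Q, roundProb ℓ H κ δ d t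

/-- The number of queries is too large relative to the sampling probabilities. -/
def ReachesQuery (ℓ : Z → Y → ℝ) (H : Finset (X → Z)) (κ δ : ℝ)
    (d : ℕ → (X × Y) × ℝ) (Q : ℕ) : Prop :=
  Real.log (2 * (3 + (Q : ℝ)) * (Q : ℝ) ^ 2 / δ) ≤ 1 / 3 * querySum ℓ H κ δ d Q -
    2 / 5 * ∑ t ∈ Finset.range Q, roundProb ℓ H κ δ d t

variable [MeasurableSpace Z] [Finite Y] [MeasurableSingletonClass Y]
  {ℓ : Z → Y → ℝ} {H : Finset (X → Z)} {κ δ : ℝ}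

/-- The crude bound for the low-variance regime: in each round the risk difference is at most the
mean query probability, and minus the weighted difference is at most q. -/
lemma excess_le (hℓm : ∀ y, Measurable fun z => ℓ z y) (hℓ : ∀ z y, 0 ≤ ℓ z y ∧ ℓ z y ≤ 1)
    (hH : ∀ h ∈ H, Measurable h) {D : Measure (X × Y)} [IsProbabilityMeasure D]
    {d : ℕ → (X × Y) × ℝ} {g f : X → Z} {n : ℕ} (hg : g ∈ versionSpace ℓ H κ δ d n)
    (hf : f ∈ versionSpace ℓ H κ δ d n) :
    excess D ℓ H κ δ d g f (n + 1) ≤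
      querySum ℓ H κ δ d (n + 1) + meanSum D ℓ H κ δ d (n + 1) := by
  rw [excess, querySum, meanSum, ← Finset.sum_add_distrib]
  refine Finset.sum_le_sum fun i hi => ?_
  have hin : i ≤ n := Nat.lt_succ_iff.1 (Finset.mem_range.1 hi)
  have hg' := versionSpace_antitone hin hg
  have hf' := versionSpace_antitone hin hf
  have hV : ∀ h ∈ versionSpace ℓ H κ δ d i, Measurable h := fun h hh =>
    hH h (versionSpace_subset i hh)
  have h1 := (abs_le.1 (abs_weightedDiff_le (ℓ := ℓ) hf' hg' (d i))).1
  have h2 : risk D ℓ g - risk D ℓ f ≤ meanProb D ℓ (versionSpace ℓ H κ δ d i) := by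
    rw [← integral_weightedDiff hℓm hℓ hV hg' hf', ← integral_query hℓm hℓ hV]
    exact integral_mono (integrable_weightedDiff hℓm hV hg' hf') (integrable_query hℓm hV)
      fun e => (le_abs_self _).trans (abs_weightedDiff_le hf' hg' e)
  linarith

variable {Ω : Type*} [MeasurableSpace Ω] {μ : Measure Ω} [IsProbabilityMeasure μ]
  {D : Measure (X × Y)} {ζ : ℕ → Ω → (X × Y) × ℝ}

lemma measure_run_sum_ge_le (hℓm : ∀ y, Measurable fun z => ℓ z y) (hH : ∀ h ∈ H, Measurable h)
    (hζ : ∀ t, Measurable (ζ t)) (hind : iIndepFun ζ μ) (hlaw : ∀ t, μ.map (ζ t) = D.prod coin)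
    {ξ : Finset (X → Z) → (X × Y) × ℝ → ℝ} (hξ : ∀ v ⊆ H, Measurable (ξ v))
    (hξ1 : ∀ v ⊆ H, ∫⁻ e, ENNReal.ofReal (Real.exp (ξ v e)) ∂D.prod coin ≤ 1) (n : ℕ) (L : ℝ) :
    μ {ω | L ≤ ∑ i ∈ Finset.range n, ξ (versionSpace ℓ H κ δ (fun t => ζ t ω) i) (ζ i ω)} ≤
      ENNReal.ofReal (Real.exp (-L)) :=
  measure_sum_ge_le (s := H.powerset) (V := fun i ω => versionSpace ℓ H κ δ (fun t => ζ t ω) i)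
    hζ hind hlaw (fun n _ => Finset.mem_powerset.2 (versionSpace_subset n))
    (fun n => (measurable_run hℓm hH n).2) (fun v hv => hξ v (Finset.mem_powerset.1 hv))
    (fun v hv => hξ1 v (Finset.mem_powerset.1 hv)) n L

variable [IsProbabilityMeasure D]

/-- The tail bound for sums that are only controlled while `g` and `f` are in the version space. -/
lemma measure_pair_sum_ge_le (hℓm : ∀ y, Measurable fun z => ℓ z y) (hH : ∀ h ∈ H, Measurable h)
    (hζ : ∀ t, Measurable (ζ t)) (hind : iIndepFun ζ μ) (hlaw : ∀ t, μ.map (ζ t) = D.prod coin)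
    (g f : X → Z) {ξ : Finset (X → Z) → (X × Y) × ℝ → ℝ}
    (hξ : ∀ v ⊆ H, g ∈ v → f ∈ v → Measurable (ξ v))
    (hξ1 : ∀ v ⊆ H, g ∈ v → f ∈ v →
      ∫⁻ e, ENNReal.ofReal (Real.exp (ξ v e)) ∂D.prod coin ≤ 1) (n : ℕ) (L : ℝ) :
    μ {ω | (g ∈ versionSpace ℓ H κ δ (fun t => ζ t ω) n ∧
        f ∈ versionSpace ℓ H κ δ (fun t => ζ t ω) n) ∧
        L ≤ ∑ i ∈ Finset.range (n + 1), ξ (versionSpace ℓ H κ δ (fun t => ζ t ω) i) (ζ i ω)} ≤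
      ENNReal.ofReal (Real.exp (-L)) := by
  classical
  -- The increment is replaced by 0 once `g` or `f` is eliminated, where no moment bound is
  -- available. Version spaces decrease, so on the event considered no increment is changed.
  refine (measure_mono ?_).trans (measure_run_sum_ge_le (κ := κ) (δ := δ) hℓm hH hζ hind hlaw
    (ξ := fun v e => if g ∈ v ∧ f ∈ v then ξ v e else 0) (fun v hv => ?_) (fun v hv => ?_)
    (n + 1) L)
  · rintro ω ⟨⟨hg, hf⟩, h⟩
    refine h.trans (Finset.sum_le_sum fun i hi => ?_)
    have hin : i ≤ n := Nat.lt_succ_iff.1 (Finset.mem_range.1 hi)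
    rw [if_pos ⟨versionSpace_antitone hin hg, versionSpace_antitone hin hf⟩]
  · by_cases h : g ∈ v ∧ f ∈ v
    · simpa only [h, and_self, if_true] using hξ v hv h.1 h.2
    · simp only [h, if_false]
      exact measurable_const
  · by_cases h : g ∈ v ∧ f ∈ v
    · simpa only [h, and_self, if_true] using hξ1 v hv h.1 h.2
    · simp [h]

lemma measure_reachesSlack_le (hℓm : ∀ y, Measurable fun z => ℓ z y)
    (hℓ : ∀ z y, 0 ≤ ℓ z y ∧ ℓ z y ≤ 1) (hH : ∀ h ∈ H, Measurable h)
    (hζ : ∀ t, Measurable (ζ t)) (hind : iIndepFun ζ μ) (hlaw : ∀ t, μ.map (ζ t) = D.prod coin)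
    (hδ : 0 < δ) (hδ1 : δ < 1) {f : X → Z} (hf : f ∈ H) (n : ℕ) :
    μ {ω | ReachesSlack D ℓ H κ δ f (fun t => ζ t ω) n} ≤
      ENNReal.ofReal (δ / (2 * ((n : ℝ) + 1) * ((n : ℝ) + 2))) := by
  have hm : 1 ≤ H.card := Finset.card_pos.2 ⟨f, hf⟩
  have hm' : (1 : ℝ) ≤ H.card := by exact_mod_cast hm
  -- The slack itself is the optimal Hoeffding parameter: a deviation of (n+1)c gives exponent
  -- (n+1)c² - (n+1)c²/2 = (n+1)c²/2.
  set c := slack H.card δ (n + 1) with hc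
  have hc0 : 0 < c := slack_pos hm hδ hδ1 n
  have hsub : {ω | ReachesSlack D ℓ H κ δ f (fun t => ζ t ω) n} ⊆
      ⋃ g ∈ H, {ω | (g ∈ versionSpace ℓ H κ δ (fun t => ζ t ω) n ∧
        f ∈ versionSpace ℓ H κ δ (fun t => ζ t ω) n) ∧
        ((n : ℝ) + 1) * c ^ 2 / 2 ≤ ∑ i ∈ Finset.range (n + 1),
          (c * (risk D ℓ g - risk D ℓ f -
            weightedDiff ℓ (versionSpace ℓ H κ δ (fun t => ζ t ω) i) g f (ζ i ω)) - c ^ 2 / 2)} := by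
    rintro ω ⟨g, hg, hgf, h⟩
    refine Set.mem_iUnion₂.2 ⟨g, hg, hgf, ?_⟩
    rw [Finset.sum_sub_distrib, ← Finset.mul_sum]
    change _ ≤ c * excess D ℓ H κ δ (fun t => ζ t ω) g f (n + 1) - _
    simp only [Finset.sum_const, Finset.card_range, nsmul_eq_mul]
    push_cast
    nlinarith [mul_le_mul_of_nonneg_left h hc0.le]
  calc _ ≤ _ := measure_mono hsub
    _ ≤ ∑ g ∈ H, _ := measure_biUnion_finset_le _ _
    _ ≤ ∑ _g ∈ H, ENNReal.ofReal (Real.exp (-(((n : ℝ) + 1) * c ^ 2 / 2))) := by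
        refine Finset.sum_le_sum fun g hg => ?_
        refine measure_pair_sum_ge_le hℓm hH hζ hind hlaw g f
          (ξ := fun v e => c * (risk D ℓ g - risk D ℓ f - weightedDiff ℓ v g f e) - c ^ 2 / 2)
          (fun v hv hgv hfv => ?_) (fun v hv hgv hfv => ?_) n _
        · exact ((measurable_const.sub (measurable_weightedDiff hℓm (fun h hh => hH h (hv hh))
            (hH g hg) (hH f hf))).const_mul c).sub_const _
        · exact lintegral_exp_hoeffding_le hℓm hℓ (fun h hh => hH h (hv hh)) hgv hfv c
    _ ≤ _ := by
        rw [exp_neg_slack_sq hm hδ hδ1, Finset.sum_const, nsmul_eq_mul,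
          ← ENNReal.ofReal_natCast, ← ENNReal.ofReal_mul (by positivity)]
        apply ENNReal.ofReal_le_ofReal
        rw [mul_div_assoc', div_le_div_iff₀ (by positivity) (by positivity)]
        have : (H.card : ℝ) ≤ (H.card : ℝ) ^ 2 := by nlinarith
        have h0 : 0 ≤ δ * (2 * ((n : ℝ) + 1) * ((n : ℝ) + 2)) := by positivity
        nlinarith [mul_le_mul_of_nonneg_left this h0]

lemma measure_reachesBernstein_le (hℓm : ∀ y, Measurable fun z => ℓ z y)
    (hℓ : ∀ z y, 0 ≤ ℓ z y ∧ ℓ z y ≤ 1) (hH : ∀ h ∈ H, Measurable h)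
    (hζ : ∀ t, Measurable (ζ t)) (hind : iIndepFun ζ μ) (hlaw : ∀ t, μ.map (ζ t) = D.prod coin)
    (hδ : 0 < δ) {f : X → Z} (hf : f ∈ H) {Q : ℕ} (hQ : 2 ≤ Q) :
    μ {ω | ReachesBernstein D ℓ H κ δ f (fun t => ζ t ω) Q} ≤
      ENNReal.ofReal (3 * δ / (16 * (Q : ℝ) ^ 2)) := by
  have hm : 1 ≤ H.card := Finset.card_pos.2 ⟨f, hf⟩
  have hm' : (1 : ℝ) ≤ H.card := by exact_mod_cast hm
  have hQ1 : Q - 1 + 1 = Q := by omega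
  have hQ2 : (2 : ℝ) ≤ Q := by exact_mod_cast hQ
  set L := Real.log (16 * (Q : ℝ) ^ 2 * (H.card : ℝ) ^ 2 * Real.log (Q : ℝ) / δ) with hL
  have hsub : {ω | ReachesBernstein D ℓ H κ δ f (fun t => ζ t ω) Q} ⊆
      ⋃ g ∈ H, ⋃ k ∈ Finset.range (Nat.log 2 Q + 1),
        {ω | (g ∈ versionSpace ℓ H κ δ (fun t => ζ t ω) (Q - 1) ∧
        f ∈ versionSpace ℓ H κ δ (fun t => ζ t ω) (Q - 1)) ∧
        L ≤ ∑ i ∈ Finset.range (Q - 1 + 1),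
          ((1 / 2 : ℝ) ^ k * (risk D ℓ g - risk D ℓ f -
            weightedDiff ℓ (versionSpace ℓ H κ δ (fun t => ζ t ω) i) g f (ζ i ω)) -
          13 / 18 * ((1 / 2 : ℝ) ^ k) ^ 2 *
            meanProb D ℓ (versionSpace ℓ H κ δ (fun t => ζ t ω) i))} := by
    rintro ω ⟨g, hg, k, hk, hgf, h⟩
    refine Set.mem_iUnion₂.2 ⟨g, hg, Set.mem_iUnion₂.2 ⟨k, hk, hgf, ?_⟩⟩
    rw [Finset.sum_sub_distrib, ← Finset.mul_sum, ← Finset.mul_sum, hQ1]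
    exact h
  calc _ ≤ _ := measure_mono hsub
    _ ≤ ∑ g ∈ H, _ := measure_biUnion_finset_le _ _
    _ ≤ ∑ g ∈ H, ∑ k ∈ Finset.range (Nat.log 2 Q + 1), _ :=
        Finset.sum_le_sum fun g _ => measure_biUnion_finset_le _ _
    _ ≤ ∑ _g ∈ H, ∑ _k ∈ Finset.range (Nat.log 2 Q + 1), ENNReal.ofReal (Real.exp (-L)) := by
        refine Finset.sum_le_sum fun g hg => Finset.sum_le_sum fun k _ => ?_
        refine measure_pair_sum_ge_le hℓm hH hζ hind hlaw g f
          (ξ := fun v e => (1 / 2 : ℝ) ^ k * (risk D ℓ g - risk D ℓ f - weightedDiff ℓ v g f e) -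
            13 / 18 * ((1 / 2 : ℝ) ^ k) ^ 2 * meanProb D ℓ v)
          (fun v hv hgv hfv => ?_) (fun v hv hgv hfv => ?_) (Q - 1) _
        · exact ((measurable_const.sub (measurable_weightedDiff hℓm (fun h hh => hH h (hv hh))
            (hH g hg) (hH f hf))).const_mul _).sub_const _
        · exact lintegral_exp_bernstein_le hℓm hℓ (fun h hh => hH h (hv hh)) hgv hfv
            (by positivity) (pow_le_one₀ (by norm_num) (by norm_num))
    _ ≤ _ := by
        rw [exp_neg_log_pairs hm hQ hδ, Finset.sum_const, Finset.sum_const, Finset.card_range,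
          nsmul_eq_mul, nsmul_eq_mul, ← ENNReal.ofReal_natCast, ← ENNReal.ofReal_natCast,
          ← ENNReal.ofReal_mul (by positivity), ← ENNReal.ofReal_mul (by positivity)]
        apply ENNReal.ofReal_le_ofReal
        have hlog := half_le_log hQ
        have hlog0 : 0 < Real.log Q := by linarith
        have hn := natLog_add_one_le hQ
        push_cast
        calc (H.card : ℝ) * (((Nat.log 2 Q : ℝ) + 1) *
              (δ / (16 * (Q : ℝ) ^ 2 * (H.card : ℝ) ^ 2 * Real.log Q)))
            ≤ (H.card : ℝ) * ((3 * Real.log Q) *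
              (δ / (16 * (Q : ℝ) ^ 2 * (H.card : ℝ) ^ 2 * Real.log Q))) := by gcongr
          _ = 3 * δ / (16 * (Q : ℝ) ^ 2) / H.card := by field_simp
          _ ≤ _ := div_le_self (by positivity) hm'

lemma measure_reachesMean_le (hℓm : ∀ y, Measurable fun z => ℓ z y)
    (hℓ : ∀ z y, 0 ≤ ℓ z y ∧ ℓ z y ≤ 1) (hH : ∀ h ∈ H, Measurable h)
    (hζ : ∀ t, Measurable (ζ t)) (hind : iIndepFun ζ μ) (hlaw : ∀ t, μ.map (ζ t) = D.prod coin)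
    (hδ : 0 < δ) {Q : ℕ} (hQ : 2 ≤ Q) :
    μ {ω | ReachesMean D ℓ H κ δ (fun t => ζ t ω) Q} ≤
      ENNReal.ofReal (δ / (2 * (3 + (Q : ℝ)) * (Q : ℝ) ^ 2)) := by
  rw [← exp_neg_log_rounds hQ hδ]
  convert measure_run_sum_ge_le (κ := κ) (δ := δ) hℓm hH hζ hind hlaw
    (ξ := fun v e => 5 / 18 * meanProb D ℓ v - 1 / 3 * samplingProb ℓ v e.1.1)
    (fun v hv => ?_) (fun v hv => ?_) Q _ using 4
  · rw [ReachesMean, Finset.sum_sub_distrib, ← Finset.mul_sum, ← Finset.mul_sum]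
    rfl
  · exact ((((measurable_samplingProb hℓm fun h hh => hH h (hv hh)).comp
      measurable_fst.fst).const_mul _).const_sub _)
  · exact lintegral_exp_meanProb_sub_le hℓm hℓ fun h hh => hH h (hv hh)

lemma measure_reachesQuery_le (hℓm : ∀ y, Measurable fun z => ℓ z y)
    (hℓ : ∀ z y, 0 ≤ ℓ z y ∧ ℓ z y ≤ 1) (hH : ∀ h ∈ H, Measurable h)
    (hζ : ∀ t, Measurable (ζ t)) (hind : iIndepFun ζ μ) (hlaw : ∀ t, μ.map (ζ t) = D.prod coin)
    (hδ : 0 < δ) {Q : ℕ} (hQ : 2 ≤ Q) :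
    μ {ω | ReachesQuery ℓ H κ δ (fun t => ζ t ω) Q} ≤
      ENNReal.ofReal (δ / (2 * (3 + (Q : ℝ)) * (Q : ℝ) ^ 2)) := by
  rw [← exp_neg_log_rounds hQ hδ]
  convert measure_run_sum_ge_le (κ := κ) (δ := δ) hℓm hH hζ hind hlaw
    (ξ := fun v e => 1 / 3 * query ℓ v e - 2 / 5 * samplingProb ℓ v e.1.1)
    (fun v hv => ?_) (fun v hv => ?_) Q _ using 4
  · rw [ReachesQuery, Finset.sum_sub_distrib, ← Finset.mul_sum, ← Finset.mul_sum]
    rfl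
  · exact ((measurable_query hℓm fun h hh => hH h (hv hh)).const_mul _).sub
      (((measurable_samplingProb hℓm fun h hh => hH h (hv hh)).comp
        measurable_fst.fst).const_mul _)
  · exact lintegral_exp_query_sub_le hℓm hℓ fun h hh => hH h (hv hh)

/-- Some bound used in the analysis fails at the `n`-th stage. -/
def Fails (D : Measure (X × Y)) (ℓ : Z → Y → ℝ) (H : Finset (X → Z)) (κ δ : ℝ)
    (f : X → Z) (d : ℕ → (X × Y) × ℝ) (n : ℕ) : Prop :=
  (ReachesSlack D ℓ H κ δ f d n ∨ ReachesBernstein D ℓ H κ δ f d (n + 2)) ∨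
    (ReachesMean D ℓ H κ δ d (n + 2) ∨ ReachesQuery ℓ H κ δ d (n + 2))

lemma measure_fails_le (hℓm : ∀ y, Measurable fun z => ℓ z y)
    (hℓ : ∀ z y, 0 ≤ ℓ z y ∧ ℓ z y ≤ 1) (hH : ∀ h ∈ H, Measurable h)
    (hζ : ∀ t, Measurable (ζ t)) (hind : iIndepFun ζ μ) (hlaw : ∀ t, μ.map (ζ t) = D.prod coin)
    (hδ : 0 < δ) (hδ1 : δ < 1) {f : X → Z} (hf : f ∈ H) (n : ℕ) :
    μ {ω | Fails D ℓ H κ δ f (fun t => ζ t ω) n} ≤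
      ENNReal.ofReal (δ / ((n : ℝ) + 1) - δ / ((n : ℝ) + 2)) := by
  have hQ : 2 ≤ n + 2 := by omega
  calc _ ≤ (μ _ + μ _) + (μ _ + μ _) :=
        (measure_union_le _ _).trans (add_le_add (measure_union_le _ _) (measure_union_le _ _))
    _ ≤ _ := add_le_add (add_le_add
        (measure_reachesSlack_le hℓm hℓ hH hζ hind hlaw hδ hδ1 hf n)
        (measure_reachesBernstein_le hℓm hℓ hH hζ hind hlaw hδ hf hQ))
        (add_le_add (measure_reachesMean_le hℓm hℓ hH hζ hind hlaw hδ hQ)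
          (measure_reachesQuery_le hℓm hℓ hH hζ hind hlaw hδ hQ))
    _ ≤ _ := by
        rw [← ENNReal.ofReal_add (by positivity) (by positivity),
          ← ENNReal.ofReal_add (by positivity) (by positivity),
          ← ENNReal.ofReal_add (by positivity) (by positivity)]
        apply ENNReal.ofReal_le_ofReal
        push_cast
        have hn : (0 : ℝ) ≤ n := by positivity
        have hsq : ((n : ℝ) + 1) * (n + 2) ≤ ((n : ℝ) + 2) ^ 2 := by nlinarith
        -- In units of `w` the four failure probabilities are at most 1/2, 3/16, 1/10 and 1/10, with
        -- sum below 1; `w` is the telescoping difference.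
        set w := δ / (((n : ℝ) + 1) * (n + 2)) with hw
        have hw0 : 0 ≤ w := by positivity
        have h0 : δ / ((n : ℝ) + 1) - δ / ((n : ℝ) + 2) = w := by
          rw [hw]; field_simp; ring
        have h1 : δ / (2 * ((n : ℝ) + 1) * ((n : ℝ) + 2)) = w / 2 := by
          rw [hw]; field_simp
        have h2 : δ / ((n : ℝ) + 2) ^ 2 ≤ w :=
          div_le_div_of_nonneg_left hδ.le (by positivity) hsq
        have h3 : 3 * δ / (16 * ((n : ℝ) + 2) ^ 2) ≤ 3 / 16 * w := by
          calc _ = 3 / 16 * (δ / ((n : ℝ) + 2) ^ 2) := by field_simp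
            _ ≤ _ := by linarith
        have h4 : δ / (2 * (3 + ((n : ℝ) + 2)) * ((n : ℝ) + 2) ^ 2) ≤ 1 / 10 * w := by
          calc _ ≤ δ / (10 * ((n : ℝ) + 2) ^ 2) := by
                apply div_le_div_of_nonneg_left hδ.le (by positivity)
                gcongr
                linarith
            _ = 1 / 10 * (δ / ((n : ℝ) + 2) ^ 2) := by field_simp
            _ ≤ _ := by linarith
        rw [h0, h1]
        linarith

lemma measure_exists_fails_le (hℓm : ∀ y, Measurable fun z => ℓ z y)
    (hℓ : ∀ z y, 0 ≤ ℓ z y ∧ ℓ z y ≤ 1) (hH : ∀ h ∈ H, Measurable h)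
    (hζ : ∀ t, Measurable (ζ t)) (hind : iIndepFun ζ μ) (hlaw : ∀ t, μ.map (ζ t) = D.prod coin)
    (hδ : 0 < δ) (hδ1 : δ < 1) {f : X → Z} (hf : f ∈ H) :
    μ {ω | ∃ n, Fails D ℓ H κ δ f (fun t => ζ t ω) n} ≤ ENNReal.ofReal δ := by
  have : {ω | ∃ n, Fails D ℓ H κ δ f (fun t => ζ t ω) n} =
      ⋃ n, {ω | Fails D ℓ H κ δ f (fun t => ζ t ω) n} := by
    ext ω; simp
  rw [this]
  refine (measure_iUnion_le _).trans ((ENNReal.tsum_le_tsum fun n =>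
    measure_fails_le hℓm hℓ hH hζ hind hlaw hδ hδ1 hf n).trans ?_)
  refine ENNReal.tsum_le_of_sum_range_le fun N => ?_
  rw [← ENNReal.ofReal_sum_of_nonneg]
  · apply ENNReal.ofReal_le_ofReal
    have h := Finset.sum_range_sub' (fun n : ℕ => δ / ((n : ℝ) + 1)) N
    calc _ = ∑ n ∈ Finset.range N, (δ / ((n : ℝ) + 1) - δ / (((n + 1 : ℕ) : ℝ) + 1)) := by
          refine Finset.sum_congr rfl fun n _ => ?_
          push_cast
          ring
      _ = δ / ((0 : ℕ) + 1) - δ / ((N : ℝ) + 1) := h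
      _ ≤ δ := by
          have : 0 ≤ δ / ((N : ℝ) + 1) := by positivity
          simp only [Nat.cast_zero, zero_add, div_one]
          linarith
  · intro n _
    rw [sub_nonneg]
    exact div_le_div_of_nonneg_left hδ.le (by positivity) (by linarith)

end Events

/-! ### Survival of the best hypothesis and the excess risk -/

section Risk

variable {X Z Y : Type*} [MeasurableSpace X] [MeasurableSpace Y] {D : Measure (X × Y)}
  {ℓ : Z → Y → ℝ} {H : Finset (X → Z)} {κ δ : ℝ} {f : X → Z} {d : ℕ → (X × Y) × ℝ}

lemma excess_eq (g : X → Z) (n : ℕ) : excess D ℓ H κ δ d g f n =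
    n * (risk D ℓ g - risk D ℓ f) - ((run ℓ H κ δ d n).2 g - (run ℓ H κ δ d n).2 f) := by
  rw [excess, Finset.sum_sub_distrib, sum_weightedDiff, Finset.sum_const, Finset.card_range,
    nsmul_eq_mul]

/-- A best hypothesis stays in the version space as long as no deviation reaches the slack. -/
lemma mem_versionSpace_of_not_reachesSlack (hκ : 1 ≤ κ) (hf : f ∈ H)
    (hmin : ∀ h ∈ H, risk D ℓ f ≤ risk D ℓ h) (hgood : ∀ n, ¬ ReachesSlack D ℓ H κ δ f d n)
    (n : ℕ) : f ∈ versionSpace ℓ H κ δ d n := by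
  induction n with
  | zero => exact hf
  | succ n ih =>
    refine mem_versionSpace_succ.2 ⟨ih, ?_⟩
    have hne : Nonempty (versionSpace ℓ H κ δ d n) := ⟨⟨f, ih⟩⟩
    rw [← sub_le_iff_le_add]
    refine le_ciInf fun g => ?_
    have hgH := versionSpace_subset n g.2
    have h1 : excess D ℓ H κ δ d g.1 f (n + 1) < ((n : ℝ) + 1) * slack H.card δ (n + 1) := by
      by_contra h
      exact hgood n ⟨g.1, hgH, ⟨g.2, ih⟩, not_lt.1 h⟩
    rw [excess_eq] at h1
    have hn : (0 : ℝ) < ((n + 1 : ℕ) : ℝ) := by positivity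
    -- Since `f` has least risk, discarding this term from `excess` leaves the empirical
    -- disadvantage of `f` against `g`, which is therefore below the slack.
    have h2 : 0 ≤ ((n + 1 : ℕ) : ℝ) * (risk D ℓ g.1 - risk D ℓ f) :=
      mul_nonneg hn.le (sub_nonneg.2 (hmin _ hgH))
    have hs : 0 ≤ slack H.card δ (n + 1) := Real.sqrt_nonneg _
    have h3 : ((n : ℝ) + 1) * slack H.card δ (n + 1) ≤
        ((n + 1 : ℕ) : ℝ) * (κ * slack H.card δ (n + 1)) := by
      push_cast
      exact mul_le_mul_of_nonneg_left (le_mul_of_one_le_left hs hκ) (by positivity)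
    rw [sub_le_iff_le_add, div_le_iff₀ hn, add_mul, div_mul_cancel₀ _ hn.ne']
    linarith

variable [MeasurableSpace Z] [Finite Y] [MeasurableSingletonClass Y] [IsProbabilityMeasure D]

/-- The deterministic part of the risk bound. -/
lemma risk_sub_le_riskBound (hℓm : ∀ y, Measurable fun z => ℓ z y)
    (hℓ : ∀ z y, 0 ≤ ℓ z y ∧ ℓ z y ≤ 1) (hH : ∀ h ∈ H, Measurable h) (hκ : 1 ≤ κ)
    (hδ : 0 < δ) (hδ1 : δ < 1) (hf : f ∈ H) (hmin : ∀ h ∈ H, risk D ℓ f ≤ risk D ℓ h)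
    (hgood : ∀ n, ¬ Fails D ℓ H κ δ f d n) {Q : ℕ} (hQ : 2 ≤ Q) {h : X → Z}
    (hout : IsOutput ℓ H κ δ d Q h) : risk D ℓ h - risk D ℓ f ≤ riskBound ℓ H κ δ d Q := by
  have hm : 1 ≤ H.card := Finset.card_pos.2 ⟨f, hf⟩
  have hfV := mem_versionSpace_of_not_reachesSlack hκ hf hmin
    (fun n hn => hgood n (Or.inl (Or.inl hn)))
  obtain ⟨n, rfl⟩ : ∃ n, Q = n + 2 := ⟨Q - 2, by omega⟩
  obtain ⟨hhV, hle⟩ := hout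
  have hQ0 : (0 : ℝ) < ((n + 2 : ℕ) : ℝ) := by positivity
  have hle := hle f (hfV _)
  unfold empLoss at hle
  rw [div_le_div_iff_of_pos_right hQ0] at hle
  -- The output competes with `f`, which has survived, so the empirical difference subtracted in
  -- `excess` is nonpositive.
  have hex : ((n + 2 : ℕ) : ℝ) * (risk D ℓ h - risk D ℓ f) ≤
      excess D ℓ H κ δ d h f (n + 2) := by
    rw [excess_eq]; linarith
  have hgood := hgood n
  simp only [Fails, not_or] at hgood
  obtain ⟨⟨_, hB⟩, hM, hN⟩ := hgood
  have hdev := deviation_le (D := excess D ℓ H κ δ d h f (n + 2))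
    (S := ∑ t ∈ Finset.range (n + 2), roundProb ℓ H κ δ d t)
    (V := meanSum D ℓ H κ δ d (n + 2)) (N := querySum ℓ H κ δ d (n + 2)) hQ
    (Finset.sum_nonneg fun _ _ => samplingProb_nonneg _ _)
    ((Finset.sum_le_card_nsmul _ _ 1 fun _ _ => samplingProb_le_one hℓ _ _).trans (by simp))
    (log_rounds_nonneg hQ hδ hδ1) (le_log_pairs hm hQ hδ hδ1) (log_rounds_le hm hQ hδ hδ1)
    (excess_le hℓm hℓ hH hhV (hfV _)) (not_le.1 hM).le (not_le.1 hN).le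
    (fun k hk => by
      by_contra hcon
      exact hB ⟨h, versionSpace_subset _ hhV, k, Finset.mem_range.2 (by omega),
        ⟨hhV, hfV _⟩, (not_le.1 hcon).le⟩)
  rw [riskBound, div_mul_eq_mul_div, div_mul_eq_mul_div, le_div_iff₀ hQ0, mul_comm]
  exact hex.trans hdev

end Risk

/-! ### Slope asymmetry and the label bound -/

section Labels

variable {X Z Y : Type*} {ℓ : Z → Y → ℝ} {H : Finset (X → Z)} {κ δ : ℝ}

lemma range_neg_eq {ι : Type*} (g : ι → ℝ) :
    (Set.range fun i => -g i) = -Set.range g := by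
  ext x
  simp [neg_eq_iff_eq_neg]

lemma iSup_neg_eq {ι : Type*} (g : ι → ℝ) : ⨆ i, -g i = -⨅ i, g i := by
  rw [iSup, iInf, ← Real.sSup_neg, range_neg_eq]

lemma iInf_neg_eq {ι : Type*} (g : ι → ℝ) : ⨅ i, -g i = -⨆ i, g i := by
  rw [iSup, iInf, ← Real.sInf_neg, range_neg_eq]

/-- If two predictions have different losses, then the slope asymmetry is at least one: exchanging
the two predictions inverts the ratio of slopes. -/
lemma one_le_slopeAsymmetry_of_ne {h h' : X → Z} (hh : h ∈ H) (hh' : h' ∈ H) {x x' : X} [Finite Y]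
    {y : Y} (hne : ℓ (h x) y ≠ ℓ (h' x') y) : 1 ≤ slopeAsymmetry ℓ H := by
  have hle : ∀ {k k' : X → Z}, k ∈ H → k' ∈ H → ∀ z z' : X,
      ENNReal.ofReal |⨆ y : Y, (ℓ (k z) y - ℓ (k' z') y)| /
        ENNReal.ofReal |⨅ y : Y, (ℓ (k z) y - ℓ (k' z') y)| ≤ slopeAsymmetry ℓ H := by
    intro k k' hk hk' z z'
    unfold slopeAsymmetry
    exact le_iSup₂_of_le k hk (le_iSup₂_of_le k' hk' (le_iSup₂_of_le z z' le_rfl))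
  set a := ⨆ y : Y, (ℓ (h x) y - ℓ (h' x') y) with ha
  set b := ⨅ y : Y, (ℓ (h x) y - ℓ (h' x') y) with hb
  have hA := hle hh hh' x x'
  have hB := hle hh' hh x' x
  have hsup : ⨆ y : Y, (ℓ (h' x') y - ℓ (h x) y) = -b := by
    rw [hb, ← iSup_neg_eq]
    simp only [neg_sub]
  have hinf : ⨅ y : Y, (ℓ (h' x') y - ℓ (h x) y) = -a := by
    rw [ha, ← iInf_neg_eq]
    simp only [neg_sub]
  rw [hsup, hinf, abs_neg, abs_neg] at hB
  rw [← ha, ← hb] at hA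
  -- Whichever of |a|, |b| is larger serves as numerator in one of the two orders. It is nonzero, so
  -- a vanishing denominator gives ∞ and the case 0/0 does not arise.
  have hdiv : ∀ {s t : ℝ}, s ≠ 0 → |t| ≤ |s| →
      1 ≤ ENNReal.ofReal |s| / ENNReal.ofReal |t| := by
    intro s t hs hst
    rw [ENNReal.le_div_iff_mul_le (Or.inr (by simpa using hs)) (Or.inl ENNReal.ofReal_ne_top),
      one_mul]
    exact ENNReal.ofReal_le_ofReal hst
  have hya : ℓ (h x) y - ℓ (h' x') y ≤ a :=
    le_ciSup (f := fun y => ℓ (h x) y - ℓ (h' x') y) (Set.finite_range _).bddAbove y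
  have hyb : b ≤ ℓ (h x) y - ℓ (h' x') y :=
    ciInf_le (f := fun y => ℓ (h x) y - ℓ (h' x') y) (Set.finite_range _).bddBelow y
  have hnot : a ≠ 0 ∨ b ≠ 0 := by
    by_contra hcon
    simp only [not_or, not_not] at hcon
    exact hne (sub_eq_zero.1 (le_antisymm (hcon.1 ▸ hya) (hcon.2 ▸ hyb)))
  rcases le_total |b| |a| with hab | hab
  · refine (hdiv (fun h0 => ?_) hab).trans hA
    rw [h0, abs_zero, abs_nonpos_iff] at hab
    exact hnot.elim (· h0) (· hab)
  · refine (hdiv (fun h0 => ?_) hab).trans hB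
    rw [h0, abs_zero, abs_nonpos_iff] at hab
    exact hnot.elim (· hab) (· h0)

lemma samplingProb_eq_zero {V : Finset (X → Z)} (hV : V ⊆ H)
    (heq : ∀ h ∈ H, ∀ h' ∈ H, ∀ x y, ℓ (h x) y = ℓ (h' x) y) (x : X) :
    samplingProb ℓ V x = 0 := by
  refine le_antisymm (Real.iSup_le (fun fg => Real.iSup_le (fun y => ?_) le_rfl) le_rfl)
    (samplingProb_nonneg _ _)
  rw [heq _ (hV fg.1.2) _ (hV fg.2.2), sub_self, abs_zero]

lemma labelCount_le {d : ℕ → (X × Y) × ℝ} (Q : ℕ) : labelCount ℓ H κ δ d Q ≤ Q := by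
  classical
  exact (Finset.card_filter_le _ _).trans (by simp)

variable [MeasurableSpace X] [MeasurableSpace Y] {D : Measure (X × Y)} {d : ℕ → (X × Y) × ℝ}
  {f : X → Z}

lemma expectedLabels_le [IsProbabilityMeasure D] (hℓ : ∀ z y, 0 ≤ ℓ z y ∧ ℓ z y ≤ 1) (Q : ℕ) :
    expectedLabels D ℓ H κ δ d Q ≤ Q := by
  refine (Finset.sum_le_card_nsmul _ _ 1 fun j _ => ?_).trans (by simp)
  have h := norm_integral_le_of_norm_le_const (μ := D.fst) (C := 1)
    (f := fun x => samplingProb ℓ (versionSpace ℓ H κ δ d j) x)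
    (Filter.Eventually.of_forall fun x => by
      rw [Real.norm_eq_abs, abs_of_nonneg (samplingProb_nonneg _ _)]
      exact samplingProb_le_one hℓ _ _)
  rw [probReal_univ, mul_one] at h
  exact (le_abs_self _).trans h

/-- Only the cubic term is kept. The argument of the logarithm is at least 1/δ > 2, so the logarithm
exceeds 0.69, and 4 · 0.69³ > 1; this is the origin of the constant 4. -/
lemma le_labelBound (hK : 1 ≤ slopeAsymmetry ℓ H) (hm : 1 ≤ H.card) (hδ : 0 < δ)
    (hδ2 : δ < 1 / 2) {Q : ℕ} (hQ : 1 ≤ Q) :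
    (Q : ℝ≥0∞) ≤ labelBound 4 D ℓ H f κ δ d Q := by
  have hQ' : (1 : ℝ) ≤ Q := by exact_mod_cast hQ
  have hm' : (1 : ℝ) ≤ H.card := by exact_mod_cast hm
  have hlog : 69 / 100 ≤ Real.log ((Q : ℝ) * H.card * Q / δ) := by
    have h1 : Real.log 2 ≤ Real.log ((Q : ℝ) * H.card * Q / δ) := by
      apply Real.log_le_log (by norm_num)
      rw [le_div_iff₀ hδ]
      have h2 : 1 ≤ (Q : ℝ) * H.card := one_le_mul_of_one_le_of_one_le hQ' hm'
      have h3 := one_le_mul_of_one_le_of_one_le h2 hQ'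
      linarith
    linarith [Real.log_two_gt_d9]
  have h3 : (69 / 100 : ℝ) ^ 3 ≤ Real.log ((Q : ℝ) * H.card * Q / δ) ^ 3 :=
    pow_le_pow_left₀ (by norm_num) hlog 3
  have hle : (Q : ℝ≥0∞) ≤
      ENNReal.ofReal (4 * (Q * Real.log ((Q : ℝ) * H.card * Q / δ) ^ 3)) := by
    rw [← ENNReal.ofReal_natCast]
    apply ENNReal.ofReal_le_ofReal
    norm_num at h3
    nlinarith
  unfold labelBound
  exact (hle.trans le_add_self).trans (le_mul_of_one_le_left' hK)

end Labels

/-! ### The two probabilistic statements -/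

section Main

variable {X Z Y Ω : Type*} [MeasurableSpace X] [Finite Y] [MeasurableSpace Y]
  [MeasurableSpace Ω] {μ : Measure Ω} [IsProbabilityMeasure μ]
  {D : Measure (X × Y)} [IsProbabilityMeasure D] {ℓ : Z → Y → ℝ} {H : Finset (X → Z)}
  {f : X → Z} {ζ : ℕ → Ω → (X × Y) × ℝ} {κ δ : ℝ}

lemma measure_risk_sub_le_riskBound [MeasurableSpace Z] [MeasurableSingletonClass Y]
    (hℓm : ∀ y, Measurable fun z => ℓ z y)
    (hℓ : ∀ z y, 0 ≤ ℓ z y ∧ ℓ z y ≤ 1) (hH : ∀ h ∈ H, Measurable h) (hf : f ∈ H)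
    (hmin : ∀ h ∈ H, risk D ℓ f ≤ risk D ℓ h) (hζ : ∀ t, Measurable (ζ t))
    (hind : iIndepFun ζ μ) (hlaw : ∀ t, μ.map (ζ t) = D.prod coin) (hκ : 1 ≤ κ) (hδ : 0 < δ) :
    ENNReal.ofReal (1 - δ) ≤ μ {ω | ∀ Q : ℕ, 2 ≤ Q → ∀ h : X → Z,
      IsOutput ℓ H κ δ (fun t => ζ t ω) Q h →
        risk D ℓ h - risk D ℓ f ≤ riskBound ℓ H κ δ (fun t => ζ t ω) Q} := by
  rcases le_or_gt 1 δ with hδ1 | hδ1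
  · rw [ENNReal.ofReal_of_nonpos (by linarith)]
    exact zero_le
  set G := {ω | ∀ Q : ℕ, 2 ≤ Q → ∀ h : X → Z, IsOutput ℓ H κ δ (fun t => ζ t ω) Q h →
    risk D ℓ h - risk D ℓ f ≤ riskBound ℓ H κ δ (fun t => ζ t ω) Q} with hG
  have hGc : μ Gᶜ ≤ ENNReal.ofReal δ := by
    refine (measure_mono fun ω hω => ?_).trans
      (measure_exists_fails_le (κ := κ) hℓm hℓ hH hζ hind hlaw hδ hδ1 hf)
    by_contra hgood
    exact hω fun Q hQ h hout => risk_sub_le_riskBound hℓm hℓ hH hκ hδ hδ1 hf hmin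
      (fun n hn => hgood ⟨n, hn⟩) hQ hout
  rw [ENNReal.ofReal_sub _ hδ.le, ENNReal.ofReal_one, tsub_le_iff_right]
  -- Subadditivity avoids proving that `G` is measurable.
  calc (1 : ℝ≥0∞) = μ (G ∪ Gᶜ) := by rw [Set.union_compl_self, measure_univ]
    _ ≤ μ G + μ Gᶜ := measure_union_le _ _
    _ ≤ _ := by gcongr

lemma measure_labels_le_labelBound (hℓ : ∀ z y, 0 ≤ ℓ z y ∧ ℓ z y ≤ 1) (hf : f ∈ H)
    (hζ : ∀ t, Measurable (ζ t)) (hlaw : ∀ t, μ.map (ζ t) = D.prod coin) (hδ : 0 < δ) :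
    ENNReal.ofReal (1 - 2 * δ) ≤ μ {ω | ∀ Q : ℕ, 1 ≤ Q →
      (labelCount ℓ H κ δ (fun t => ζ t ω) Q : ℝ≥0∞) ≤
          labelBound 4 D ℓ H f κ δ (fun t => ζ t ω) Q ∧
      ENNReal.ofReal (expectedLabels D ℓ H κ δ (fun t => ζ t ω) Q) ≤
          labelBound 4 D ℓ H f κ δ (fun t => ζ t ω) Q} := by
  have hm : 1 ≤ H.card := Finset.card_pos.2 ⟨f, hf⟩
  rcases le_or_gt (1 / 2) δ with hδ2 | hδ2
  · rw [ENNReal.ofReal_of_nonpos (by linarith)]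
    exact zero_le
  suffices hae : ∀ᵐ ω ∂μ, ∀ Q : ℕ, 1 ≤ Q →
      (labelCount ℓ H κ δ (fun t => ζ t ω) Q : ℝ≥0∞) ≤
        labelBound 4 D ℓ H f κ δ (fun t => ζ t ω) Q ∧
      ENNReal.ofReal (expectedLabels D ℓ H κ δ (fun t => ζ t ω) Q) ≤
        labelBound 4 D ℓ H f κ δ (fun t => ζ t ω) Q by
    rw [measure_congr (Filter.eventuallyEq_univ.2 hae), measure_univ]
    simpa using hδ.le
  by_cases heq : ∀ h ∈ H, ∀ h' ∈ H, ∀ x y, ℓ (h x) y = ℓ (h' x) y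
  -- With p = 0 a label is requested only for a negative coin, which is a null event; here K_ℓ may
  -- be 0, so the counts must vanish exactly.
  · have hcoin : ∀ t, ∀ᵐ ω ∂μ, 0 ≤ (ζ t ω).2 := by
      intro t
      have h1 : ∀ᵐ e ∂(D.prod coin), 0 ≤ e.2 :=
        (Measure.quasiMeasurePreserving_snd (μ := D) (ν := coin)).ae
          ((ae_restrict_mem measurableSet_Icc).mono fun u hu => hu.1)
      rw [← hlaw t] at h1
      exact ae_of_ae_map (hζ t).aemeasurable h1
    filter_upwards [ae_all_iff.2 hcoin] with ω hω Q _
    have hp : ∀ j x, samplingProb ℓ (versionSpace ℓ H κ δ (fun t => ζ t ω) j) x = 0 :=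
      fun j => samplingProb_eq_zero (versionSpace_subset j) heq
    have h1 : labelCount ℓ H κ δ (fun t => ζ t ω) Q = 0 := by
      rw [labelCount, Finset.card_eq_zero, Finset.filter_eq_empty_iff]
      intro j _
      rw [roundProb, hp]
      exact not_lt.2 (hω j)
    have h2 : expectedLabels D ℓ H κ δ (fun t => ζ t ω) Q = 0 := by
      simp [expectedLabels, hp]
    simp [h1, h2]
  · push Not at heq
    obtain ⟨h, hh, h', hh', x, y, hne⟩ := heq
    have hK := one_le_slopeAsymmetry_of_ne hh hh' hne
    refine Filter.Eventually.of_forall fun ω Q hQ => ⟨?_, ?_⟩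
    · exact (Nat.cast_le.2 (labelCount_le Q)).trans (le_labelBound hK hm hδ hδ2 hQ)
    · refine le_trans ?_ (le_labelBound hK hm hδ hδ2 hQ)
      rw [← ENNReal.ofReal_natCast]
      exact ENNReal.ofReal_le_ofReal (expectedLabels_le hℓ Q)

end Main

end IWAL

theorem theorem1 :
    ∃ C : ℝ, 0 < C ∧
      ∀ (X Z Y Ω : Type*) [MeasurableSpace X] [MeasurableSpace Z]
        [Fintype Y] [MeasurableSpace Y] [MeasurableSingletonClass Y] [MeasurableSpace Ω]
        (μ : Measure Ω) [IsProbabilityMeasure μ]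
        (D : Measure (X × Y)) [IsProbabilityMeasure D]
        -- a bounded loss and a finite class of measurable hypotheses
        (ℓ : Z → Y → ℝ) (_ : ∀ y, Measurable fun z => ℓ z y)
        (_ : ∀ z y, 0 ≤ ℓ z y ∧ ℓ z y ≤ 1)
        (H : Finset (X → Z)) (_ : ∀ h ∈ H, Measurable h)
        -- a best hypothesis in the class
        (hstar : X → Z) (_ : hstar ∈ H) (_ : ∀ h ∈ H, IWAL.risk D ℓ hstar ≤ IWAL.risk D ℓ h)
        -- i.i.d. examples from `D`, each with an independent uniform coin
        (ζ : ℕ → Ω → (X × Y) × ℝ) (_ : ∀ t, Measurable (ζ t)) (_ : iIndepFun ζ μ)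
        (_ : ∀ t, μ.map (ζ t) = D.prod (volume.restrict (Set.Icc (0 : ℝ) 1)))
        (κ δ : ℝ) (_ : 1 ≤ κ) (_ : 0 < δ),
        (ENNReal.ofReal (1 - δ) ≤ μ {ω | ∀ Q : ℕ, 2 ≤ Q → ∀ h : X → Z,
          IWAL.IsOutput ℓ H κ δ (fun t => ζ t ω) Q h →
            IWAL.risk D ℓ h - IWAL.risk D ℓ hstar ≤
              IWAL.riskBound ℓ H κ δ (fun t => ζ t ω) Q}) ∧
        (ENNReal.ofReal (1 - 2 * δ) ≤ μ {ω | ∀ Q : ℕ, 1 ≤ Q →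
          (IWAL.labelCount ℓ H κ δ (fun t => ζ t ω) Q : ℝ≥0∞) ≤
              IWAL.labelBound C D ℓ H hstar κ δ (fun t => ζ t ω) Q ∧
          ENNReal.ofReal (IWAL.expectedLabels D ℓ H κ δ (fun t => ζ t ω) Q) ≤
              IWAL.labelBound C D ℓ H hstar κ δ (fun t => ζ t ω) Q}) := by
  refine ⟨4, by norm_num, ?_⟩
  intro X Z Y Ω _ _ _ _ _ _ μ _ D _ ℓ hℓm hℓ H hH hstar hstarH hmin ζ hζ hind hlaw κ δ hκ hδ
  exact ⟨IWAL.measure_risk_sub_le_riskBound hℓm hℓ hH hstarH hmin hζ hind hlaw hκ hδ,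
    IWAL.measure_labels_le_labelBound hℓ hstarH hζ hlaw hδ⟩
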